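/- Let $V(x) = -\tfrac32 \cosh(x/2)^{-2}$ for $x \in \mathbb{R}$. For $k > 0$ consider on the complex Hilbert space $L^2(\mathbb{R})$ the operators $D_k = -\partial_x^2 + k^2$ and $H_k = D_k + 1 + V$, both with domain $H^2(\mathbb{R})$, and their product $D_k H_k$, with domain $\{u \in H^2(\mathbb{R}) : H_k u \in H^2(\mathbb{R})\} = H^4(\mathbb{R})$. 1. For every $k > 0$ the spectrum $\sigma(D_k H_k) \subset \mathbb{C}$ is contained in $[k^4, \infty)$. 2. There exist $\epsilon > 0$ and $C > 0$ such that for every $k$ with $0 < k < \epsilon$ the spectrum $\sigma(D_k H_k)$ has a smallest element $\zeta_0 = \zeta_0(k)$, which is an isolated point of the spectrum and an eigenvalue of geometric and algebraic multiplicity one (the eigenspace and the generalized eigenspace are both one-dimensional), with $\zeta_0 \le C k^3$; and the remaining part of the spectrum is bounded from below by $\tfrac34 k^2$, that is, $\sigma(D_k H_k) \setminus \{\zeta_0\} \subset [\tfrac34 k^2, \infty)$. -/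

import Mathlib

noncomputable section

namespace CahnHilliard

open MeasureTheory
open scoped Laplacian SchwartzMap

/-! ### Unbounded operators on a complex normed space -/

section Unbounded

variable {X : Type*} [NormedAddCommGroup X] [NormedSpace ℂ X]

/-- The product `S T` of two unbounded operators, on its natural domain
`{u ∈ dom T | T u ∈ dom S}`. -/
def opMul (S T : X →ₗ.[ℂ] X) : X →ₗ.[ℂ] X where
  domain :=
    { carrier := {u | ∃ h : u ∈ T.domain, T ⟨u, h⟩ ∈ S.domain}
      zero_mem' := ⟨T.domain.zero_mem, by
        have : T ⟨0, T.domain.zero_mem⟩ = 0 := T.map_zero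
        rw [this]; exact S.domain.zero_mem⟩
      add_mem' := by
        rintro a b ⟨ha, ha'⟩ ⟨hb, hb'⟩
        refine ⟨T.domain.add_mem ha hb, ?_⟩
        have : T ⟨a + b, T.domain.add_mem ha hb⟩ = T ⟨a, ha⟩ + T ⟨b, hb⟩ :=
          T.map_add ⟨a, ha⟩ ⟨b, hb⟩
        rw [this]; exact S.domain.add_mem ha' hb'
      smul_mem' := by
        rintro c a ⟨ha, ha'⟩
        refine ⟨T.domain.smul_mem c ha, ?_⟩
        have : T ⟨c • a, T.domain.smul_mem c ha⟩ = c • T ⟨a, ha⟩ :=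
          T.map_smul c ⟨a, ha⟩
        rw [this]; exact S.domain.smul_mem c ha' }
  toFun :=
    { toFun := fun u => S ⟨T ⟨u.1, u.2.1⟩, u.2.2⟩
      map_add' := by
        intro a b
        rw [← S.map_add]
        congr 1
        exact Subtype.ext (T.map_add ⟨a.1, a.2.1⟩ ⟨b.1, b.2.1⟩)
      map_smul' := by
        intro c a
        rw [RingHom.id_apply, ← S.map_smul]
        congr 1
        exact Subtype.ext (T.map_smul c ⟨a.1, a.2.1⟩) }

/-- The resolvent set of an unbounded operator `T`: the complex numbers `z` for which
`z - T : dom T → X` is a bijection with bounded inverse `R`. -/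
def resolventSet (T : X →ₗ.[ℂ] X) : Set ℂ :=
  {z | ∃ R : X →L[ℂ] X,
    (∀ u : T.domain, R (z • (u : X) - T u) = u) ∧
    (∀ f : X, ∃ u : T.domain, (u : X) = R f ∧ z • (u : X) - T u = f)}

/-- The spectrum of an unbounded operator. -/
def spectrum (T : X →ₗ.[ℂ] X) : Set ℂ := (resolventSet T)ᶜ

/-- The kernel of `(T - z) ^ n`, on the natural domain of the power. -/
def kerPow (T : X →ₗ.[ℂ] X) (z : ℂ) : ℕ → Submodule ℂ X
  | 0 => ⊥
  | n + 1 =>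
    { carrier := {u | ∃ h : u ∈ T.domain, T ⟨u, h⟩ - z • u ∈ kerPow T z n}
      zero_mem' := ⟨T.domain.zero_mem, by
        have : T ⟨0, T.domain.zero_mem⟩ = 0 := T.map_zero
        rw [this, smul_zero, sub_zero]; exact (kerPow T z n).zero_mem⟩
      add_mem' := by
        rintro a b ⟨ha, ha'⟩ ⟨hb, hb'⟩
        refine ⟨T.domain.add_mem ha hb, ?_⟩
        have : T ⟨a + b, T.domain.add_mem ha hb⟩ = T ⟨a, ha⟩ + T ⟨b, hb⟩ :=
          T.map_add ⟨a, ha⟩ ⟨b, hb⟩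
        rw [this, smul_add, add_sub_add_comm]
        exact (kerPow T z n).add_mem ha' hb'
      smul_mem' := by
        rintro c a ⟨ha, ha'⟩
        refine ⟨T.domain.smul_mem c ha, ?_⟩
        have : T ⟨c • a, T.domain.smul_mem c ha⟩ = c • T ⟨a, ha⟩ :=
          T.map_smul c ⟨a, ha⟩
        rw [this, smul_comm z c a, ← smul_sub]
        exact (kerPow T z n).smul_mem c ha' }

/-- The eigenspace `ker (T - z)`. -/
def eigenspace (T : X →ₗ.[ℂ] X) (z : ℂ) : Submodule ℂ X := kerPow T z 1

/-- The generalized eigenspace, the union over `n` of the kernels of `(T - z) ^ n`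
(an increasing sequence of subspaces). -/
def genEigenspace (T : X →ₗ.[ℂ] X) (z : ℂ) : Submodule ℂ X := ⨆ n, kerPow T z n

theorem mem_eigenspace {T : X →ₗ.[ℂ] X} {z : ℂ} {u : X} :
    u ∈ eigenspace T z ↔ ∃ h : u ∈ T.domain, T ⟨u, h⟩ = z • u := by
  change (∃ h : u ∈ T.domain, T ⟨u, h⟩ - z • u ∈ (⊥ : Submodule ℂ X)) ↔ _
  simp only [Submodule.mem_bot, sub_eq_zero]

end Unbounded

/-! ### The operators `D_k` and `H_k` on `L²(ℝ)` -/

/-- The complex Hilbert space `L²(ℝ)`. -/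
abbrev L2 : Type := Lp ℂ 2 (volume : Measure ℝ)

/-- The Sobolev space `H²(ℝ)`, as a subspace of `L²(ℝ)`. -/
def H2 : Submodule ℂ L2 where
  carrier := {u | TemperedDistribution.MemSobolev 2 2 (u : 𝓢'(ℝ, ℂ))}
  zero_mem' := by
    rw [Set.mem_ofPred_eq, ← Lp.toTemperedDistributionCLM_apply, map_zero]
    exact TemperedDistribution.memSobolev_fun_zero ℝ ℂ 2 2
  add_mem' := by
    intro u v hu hv
    rw [Set.mem_ofPred_eq] at hu hv ⊢
    rw [← Lp.toTemperedDistributionCLM_apply] at hu hv ⊢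
    rw [map_add]
    exact hu.add hv
  smul_mem' := by
    intro c u hu
    rw [Set.mem_ofPred_eq] at hu ⊢
    rw [← Lp.toTemperedDistributionCLM_apply] at hu ⊢
    rw [map_smul]
    exact hu.smul c

/-- The embedding of `L²(ℝ)` into the tempered distributions is injective. -/
theorem L2.toDistribution_injective {u v : L2} (h : (u : 𝓢'(ℝ, ℂ)) = (v : 𝓢'(ℝ, ℂ))) :
    u = v := by
  rw [← Lp.toTemperedDistributionCLM_apply, ← Lp.toTemperedDistributionCLM_apply] at h
  exact LinearMap.ker_eq_bot.mp
    (Lp.ker_toTemperedDistributionCLM_eq_bot (F := ℂ) (μ := (volume : Measure ℝ)) (p := 2)) h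

theorem exists_laplacian (u : H2) :
    ∃ f : L2, Δ ((u : L2) : 𝓢'(ℝ, ℂ)) = (f : 𝓢'(ℝ, ℂ)) := by
  have h : TemperedDistribution.MemSobolev (2 - 2) 2 (Δ ((u : L2) : 𝓢'(ℝ, ℂ))) :=
    TemperedDistribution.MemSobolev.laplacian u.2
  rw [sub_self] at h
  exact TemperedDistribution.memSobolev_zero_iff.mp h

/-- The second distributional derivative `u''` of `u ∈ H²(ℝ)`, as an element of `L²(ℝ)`.
(The Laplacian on the line is the second derivative.) -/
def secondDeriv (u : H2) : L2 := (exists_laplacian u).choose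

theorem secondDeriv_spec (u : H2) :
    Δ ((u : L2) : 𝓢'(ℝ, ℂ)) = (secondDeriv u : 𝓢'(ℝ, ℂ)) :=
  (exists_laplacian u).choose_spec

/-- The distributional Laplacian on the line is the second distributional derivative. -/
theorem laplacian_eq_deriv_deriv (u : 𝓢'(ℝ, ℂ)) :
    Δ u = TemperedDistribution.derivCLM ℂ (TemperedDistribution.derivCLM ℂ u) := by
  ext φ
  simp only [TemperedDistribution.laplacian_apply_apply,
    TemperedDistribution.derivCLM_apply_apply, map_neg, neg_neg]
  congr 1
  ext x
  simp [SchwartzMap.laplacian_apply, InnerProductSpace.laplacian_eq_iteratedDeriv_real,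
    iteratedDeriv_succ, SchwartzMap.derivCLM_apply]
  rfl

/-- The operator `-∂ₓ²` on `L²(ℝ)` with domain `H²(ℝ)`. -/
def negLaplacian : L2 →ₗ.[ℂ] L2 where
  domain := H2
  toFun :=
    { toFun := fun u => -secondDeriv u
      map_add' := by
        intro u v
        rw [← neg_add, neg_inj]
        apply L2.toDistribution_injective
        rw [← secondDeriv_spec, ← Lp.toTemperedDistributionCLM_apply,
          ← Lp.toTemperedDistributionCLM_apply, map_add, Submodule.coe_add, map_add,
          Lp.toTemperedDistributionCLM_apply, Lp.toTemperedDistributionCLM_apply,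
          Lp.toTemperedDistributionCLM_apply, Lp.toTemperedDistributionCLM_apply,
          ← secondDeriv_spec, ← secondDeriv_spec,
          ← TemperedDistribution.laplacianCLM_apply, map_add,
          TemperedDistribution.laplacianCLM_apply, TemperedDistribution.laplacianCLM_apply]
      map_smul' := by
        intro c u
        rw [RingHom.id_apply, smul_neg, neg_inj]
        apply L2.toDistribution_injective
        rw [← secondDeriv_spec, ← Lp.toTemperedDistributionCLM_apply,
          ← Lp.toTemperedDistributionCLM_apply, map_smul, Submodule.coe_smul, map_smul,
          Lp.toTemperedDistributionCLM_apply, Lp.toTemperedDistributionCLM_apply,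
          ← secondDeriv_spec, ← TemperedDistribution.laplacianCLM_apply, map_smul,
          TemperedDistribution.laplacianCLM_apply] }

/-- The potential `V(x) = -(3/2) cosh(x/2)⁻²`. -/
def V (x : ℝ) : ℝ := -(3 / 2) * (Real.cosh (x / 2) ^ 2)⁻¹

theorem continuous_V : Continuous V := by
  unfold V
  exact continuous_const.mul (((Real.continuous_cosh.comp (continuous_id.div_const 2)).pow 2).inv₀
    fun x => pow_ne_zero 2 (Real.cosh_pos _).ne')

theorem norm_V_le (x : ℝ) : ‖(V x : ℂ)‖ ≤ 3 / 2 := by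
  have h1 : (1 : ℝ) ≤ Real.cosh (x / 2) ^ 2 := one_le_pow₀ (Real.one_le_cosh _)
  have h2 : (Real.cosh (x / 2) ^ 2)⁻¹ ≤ 1 := inv_le_one_of_one_le₀ h1
  have h3 : 0 ≤ (Real.cosh (x / 2) ^ 2)⁻¹ := by positivity
  rw [Complex.norm_real, Real.norm_eq_abs, V, abs_mul, abs_of_nonneg h3]
  rw [abs_of_neg (by norm_num : (-(3 / 2) : ℝ) < 0)]
  linarith

theorem memLp_V_mul (u : L2) : MemLp (fun x => (V x : ℂ) * u x) 2 (volume : Measure ℝ) :=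
  MemLp.of_le_mul (c := 3 / 2) (Lp.memLp u)
    ((Complex.continuous_ofReal.comp continuous_V).aestronglyMeasurable.mul
      (Lp.memLp u).aestronglyMeasurable)
    (Filter.Eventually.of_forall fun x => by
      rw [norm_mul]
      exact mul_le_mul_of_nonneg_right (norm_V_le x) (norm_nonneg _))

/-- Multiplication by `V` on `L²(ℝ)`. -/
def mulV : L2 →ₗ[ℂ] L2 where
  toFun u := (memLp_V_mul u).toLp _
  map_add' u v := by
    rw [← MemLp.toLp_add]
    apply MemLp.toLp_congr
    filter_upwards [Lp.coeFn_add u v] with x hx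
    simp only [hx, Pi.add_apply, mul_add]
  map_smul' c u := by
    rw [RingHom.id_apply, ← MemLp.toLp_const_smul]
    apply MemLp.toLp_congr
    filter_upwards [Lp.coeFn_smul c u] with x hx
    simp only [hx, Pi.smul_apply, smul_eq_mul]
    ring

/-- `D_k = -∂ₓ² + k²` on `L²(ℝ)`, with domain `H²(ℝ)`. -/
def D (k : ℝ) : L2 →ₗ.[ℂ] L2 := ((k ^ 2 : ℂ) • (LinearMap.id : L2 →ₗ[ℂ] L2)) +ᵥ negLaplacian

/-- `H_k = D_k + 1 + V` on `L²(ℝ)`, with domain `H²(ℝ)`. -/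
def H (k : ℝ) : L2 →ₗ.[ℂ] L2 := ((LinearMap.id : L2 →ₗ[ℂ] L2) + mulV) +ᵥ D k

/-- `D_k H_k` on `L²(ℝ)`, with domain `{u ∈ H²(ℝ) | H_k u ∈ H²(ℝ)}`, which is `H⁴(ℝ)`. -/
def DH (k : ℝ) : L2 →ₗ.[ℂ] L2 := opMul (D k) (H k)

end CahnHilliard

end

/-! Both factors are symmetric with form at least `k ^ 2`, so they have positive bounded inverses
`K` of `H k` and `G` of `D k`, and `K * G` inverts `D k * H k`. Everything is read off from `K * G`.
Away from zero its spectrum is that of the positive operator `√K G √K`, hence lies in `[0, ‖K‖‖G‖]`,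
and `‖K‖‖G‖ ≤ k⁻⁴`; inverting gives the first claim.

For the second claim, `-∂² + 1 + V = A*A` with `A = ∂ + tanh(x/2)`. The kernel of `A` is spanned by
`ψ = cosh(x/2)⁻²`, and `AA* ≥ 3/4` gives a gap `3/4` on `ψ⊥` (`gap_of_orthogonal`). So `K ψ = k⁻²
ψ`, while `K` has norm at most `4/3` on `ψ⊥`.

Removing from `K` its part along `ψ` leaves an operator whose product with `G` has spectrum in `[0,
(4/3) k⁻²]`. Since the removed part has rank one, the spectrum of `K * G` above that threshold
consists of eigenvalues. A min-max argument in the form `⟪G u, u⟫`, for which `K * G` is symmetric,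
leaves at most one, and it is simple (`RankOneGap`).

Such an eigenvalue exists for small `k` because `⟪G ψ, ψ⟫ ≥ c / k`
(`exists_inner_inverse_D_lower_bound`): a Rayleigh quotient then produces a spectral point of order
at least `k⁻³`, above `(4/3) k⁻²`. Its inverse is `ζ₀`. -/

section PositiveProduct

/-! ### Spectrum of a product of two positive bounded operators. -/

open ContinuousLinearMap
open scoped ComplexOrder InnerProductSpace

set_option linter.unusedSectionVars false

variable {E : Type*} [NormedAddCommGroup E] [InnerProductSpace ℂ E] [CompleteSpace E]

/-- Away from zero, the product of two positive operators has the spectrum of a positive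
operator. -/
theorem spectrum_mul_diff_zero {K G : E →L[ℂ] E} (hK : 0 ≤ K) :
    spectrum ℂ (K * G) \ {0} = spectrum ℂ (CFC.sqrt K * G * CFC.sqrt K) \ {0} := by
  conv_lhs => rw [← CFC.sqrt_mul_sqrt_self K hK, mul_assoc]
  rw [spectrum.nonzero_mul_comm]

theorem sqrt_mul_mul_sqrt_nonneg {K G : E →L[ℂ] E} (hG : 0 ≤ G) :
    0 ≤ CFC.sqrt K * G * CFC.sqrt K := by
  have h : star (CFC.sqrt K) = CFC.sqrt K := (IsSelfAdjoint.of_nonneg (CFC.sqrt_nonneg K)).star_eq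
  have := star_left_conjugate_nonneg hG (CFC.sqrt K)
  rwa [h] at this

theorem norm_sqrt_mul_self {K : E →L[ℂ] E} (hK : 0 ≤ K) :
    ‖CFC.sqrt K‖ * ‖CFC.sqrt K‖ = ‖K‖ := by
  have h : IsSelfAdjoint (CFC.sqrt K) := IsSelfAdjoint.of_nonneg (CFC.sqrt_nonneg K)
  rw [← sq, ← h.norm_mul_self, CFC.sqrt_mul_sqrt_self K hK]

/-- `K * G` need not be self-adjoint, but its nonzero spectrum is that of `√K G √K`, which is
positive with norm at most `‖K‖‖G‖`. -/
theorem spectrum_mul_subset {K G : E →L[ℂ] E} (hK : 0 ≤ K) (hG : 0 ≤ G) :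
    spectrum ℂ (K * G) ⊆ Complex.ofReal '' Set.Icc 0 (‖K‖ * ‖G‖) := by
  intro z hz
  by_cases hz0 : z = 0
  · exact ⟨0, ⟨le_rfl, by positivity⟩, by simp [hz0]⟩
  rcases subsingleton_or_nontrivial E with hE | hE
  · have : Subsingleton (E →L[ℂ] E) := ⟨fun a b => by ext x; exact Subsingleton.elim _ _⟩
    rw [spectrum.of_subsingleton] at hz
    exact hz.elim
  have hz' : z ∈ spectrum ℂ (CFC.sqrt K * G * CFC.sqrt K) := by
    have : z ∈ spectrum ℂ (K * G) \ {0} := ⟨hz, hz0⟩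
    rw [spectrum_mul_diff_zero hK] at this
    exact this.1
  have hS := sqrt_mul_mul_sqrt_nonneg (K := K) hG
  have h0 : 0 ≤ z := spectrum_nonneg_of_nonneg hS hz'
  have h1 : ‖z‖ ≤ ‖K‖ * ‖G‖ := by
    calc ‖z‖ ≤ ‖CFC.sqrt K * G * CFC.sqrt K‖ := spectrum.norm_le_norm_of_mem hz'
      _ ≤ ‖CFC.sqrt K‖ * ‖G‖ * ‖CFC.sqrt K‖ :=
        (norm_mul_le _ _).trans (by gcongr; exact norm_mul_le _ _)
      _ = ‖K‖ * ‖G‖ := by rw [← norm_sqrt_mul_self hK]; ring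
  have h2 : z = (z.re : ℂ) := IsSelfAdjoint.mem_spectrum_eq_re (IsSelfAdjoint.of_nonneg hS) hz'
  refine ⟨z.re, ⟨(Complex.nonneg_iff.mp h0).1, (Complex.re_le_norm z).trans h1⟩, h2.symm⟩

theorem inner_mul_left_of_nonneg {K : E →L[ℂ] E} (hK : 0 ≤ K) (x y : E) :
    ⟪K x, y⟫_ℂ = ⟪x, K y⟫_ℂ :=
  (IsSelfAdjoint.of_nonneg hK).isSymmetric x y

/-- A Rayleigh quotient gives a lower bound for some point of the spectrum of a product of positive
operators. -/
theorem exists_mem_spectrum_mul {K G : E →L[ℂ] E} (hK : 0 ≤ K) (hG : 0 ≤ G) {ψ : E} (hψ : ψ ≠ 0)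
    {κ : ℝ} (hκ : 0 < κ) (hKψ : K ψ = (κ : ℂ) • ψ) (hpos : 0 < (⟪G ψ, ψ⟫_ℂ).re) :
    ∃ μ : ℝ, κ * (⟪G ψ, ψ⟫_ℂ).re ≤ μ * ‖ψ‖ ^ 2 ∧ (μ : ℂ) ∈ spectrum ℂ (K * G) := by
  have : Nontrivial E := ⟨ψ, 0, hψ⟩
  set R := CFC.sqrt K with hR
  have hRR : R * R = K := CFC.sqrt_mul_sqrt_self K hK
  have hR0 : 0 ≤ R := CFC.sqrt_nonneg K
  have hS := sqrt_mul_mul_sqrt_nonneg (K := K) hG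
  rw [← hR] at hS
  have hψ2 : 0 < ‖ψ‖ ^ 2 := by positivity
  have hn : ‖R ψ‖ ^ 2 = κ * ‖ψ‖ ^ 2 := by
    rw [← inner_self_eq_norm_sq (𝕜 := ℂ), inner_mul_left_of_nonneg hR0,
      show R (R ψ) = K ψ by rw [← hRR]; rfl, hKψ, inner_smul_right,
      inner_self_eq_norm_sq_to_K]
    simp [← Complex.ofReal_pow]
  -- The test vector is `R ψ`: as `ψ` is an eigenvector of `R * R`, both the form and the norm at `R
  -- ψ` reduce to quantities at `ψ`.
  have hq : (⟪(R * G * R) (R ψ), R ψ⟫_ℂ).re = κ ^ 2 * (⟪G ψ, ψ⟫_ℂ).re := by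
    have e : (R * G * R) (R ψ) = R (G (K ψ)) := by rw [← hRR]; rfl
    have e' : R (R ψ) = K ψ := by rw [← hRR]; rfl
    rw [e, inner_mul_left_of_nonneg hR0, e', hKψ, map_smul, inner_smul_left, inner_smul_right]
    simp; ring
  have hle : κ ^ 2 * (⟪G ψ, ψ⟫_ℂ).re ≤ ‖R * G * R‖ * (κ * ‖ψ‖ ^ 2) := by
    rw [← hq, ← hn]
    calc _ ≤ ‖(R * G * R) (R ψ)‖ * ‖R ψ‖ := (Complex.re_le_norm _).trans (norm_inner_le_norm _ _)
      _ ≤ ‖R * G * R‖ * ‖R ψ‖ * ‖R ψ‖ := by gcongr; exact le_opNorm _ _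
      _ = _ := by ring
  have hle' : κ * (⟪G ψ, ψ⟫_ℂ).re ≤ ‖R * G * R‖ * ‖ψ‖ ^ 2 := by
    refine le_of_mul_le_mul_left ?_ hκ
    linarith
  refine ⟨‖R * G * R‖, hle', ?_⟩
  -- The norm of a positive operator belongs to its spectrum, so the norm serves as `μ`.
  have hm : ((‖R * G * R‖ : ℝ) : ℂ) ∈ spectrum ℂ (R * G * R) :=
    spectrum.algebraMap_mem ℂ (CStarAlgebra.norm_mem_spectrum_of_nonneg hS)
  have hne : 0 < ‖R * G * R‖ := by
    by_contra h
    have h1 : ‖R * G * R‖ * ‖ψ‖ ^ 2 ≤ 0 := mul_nonpos_of_nonpos_of_nonneg (not_lt.mp h) hψ2.le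
    have h2 : 0 < κ * (⟪G ψ, ψ⟫_ℂ).re := mul_pos hκ hpos
    linarith
  have : ((‖R * G * R‖ : ℝ) : ℂ) ∈ spectrum ℂ (R * G * R) \ {0} :=
    ⟨hm, by simpa using norm_ne_zero_iff.mp hne.ne'⟩
  rw [hR, ← spectrum_mul_diff_zero hK] at this
  exact this.1

/-- A non-invertible rank one perturbation of an invertible operator has a kernel. -/
theorem exists_ker_of_not_isUnit_sub_rankOne {B T : E →L[ℂ] E} (hB : IsUnit B) {w : E}
    {ℓ : E →L[ℂ] ℂ} (hT : ∀ x, T x = B x - ℓ x • w) (hn : ¬ IsUnit T) : ∃ x, x ≠ 0 ∧ T x = 0 := by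
  obtain ⟨b, rfl⟩ := hB
  set u : E := (↑b⁻¹ : E →L[ℂ] E) w with hu
  have hbu : (b : E →L[ℂ] E) u = w := by
    change ((b : E →L[ℂ] E) * (↑b⁻¹ : E →L[ℂ] E)) w = w
    rw [Units.mul_inv]; rfl
  by_cases h : ℓ u = 1
  · refine ⟨u, fun h0 => by simp [h0] at h, ?_⟩
    rw [hT, hbu, h, one_smul, sub_self]
  refine (hn ?_).elim
  -- `T = B (1 - ℓ ⊗ u)` with `u = B⁻¹ w`; for `ℓ u ≠ 1` the second factor has the Sherman–Morrison
  -- inverse `1 + (1 - ℓ u)⁻¹ ℓ ⊗ u`.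
  have hTF : T = b * (1 - ℓ.smulRight u) := by
    ext x
    simp [hT, hbu]
  have h' : (1 - ℓ u) ≠ 0 := sub_ne_zero.mpr (Ne.symm h)
  rw [hTF]
  refine b.isUnit.mul ⟨⟨1 - ℓ.smulRight u, 1 + (1 - ℓ u)⁻¹ • ℓ.smulRight u, ?_, ?_⟩, rfl⟩
  · ext x
    change x + (1 - ℓ u)⁻¹ • ℓ x • u - ℓ (x + (1 - ℓ u)⁻¹ • ℓ x • u) • u = x
    simp only [map_add, map_smul, smul_eq_mul]
    match_scalars <;> field_simp; ring
  · ext x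
    change x - ℓ x • u + (1 - ℓ u)⁻¹ • ℓ (x - ℓ x • u) • u = x
    simp only [map_sub, map_smul, smul_eq_mul]
    match_scalars <;> field_simp; ring

/-- The hypotheses on a pair of positive operators `K`, `G` under which the part of the spectrum of
`K * G` above `a * b` is a single simple eigenvalue. -/
structure RankOneGap (K G : E →L[ℂ] E) (ψ : E) (κ a b : ℝ) : Prop where
  nonneg_left : 0 ≤ K
  nonneg_right : 0 ≤ G
  ne_zero : ψ ≠ 0
  apply_eq : K ψ = (κ : ℂ) • ψ
  a_nonneg : 0 ≤ a
  le_of_orthogonal : ∀ f, ⟪ψ, f⟫_ℂ = 0 → ‖K f‖ ≤ a * ‖f‖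
  -- This is `G² ≤ b G`, a form of the bound `G ≤ b` that can be used directly against `⟪G f, f⟫`.
  right_le : ∀ f, ‖G f‖ ^ 2 ≤ b * (⟪G f, f⟫_ℂ).re
  right_injective : ∀ f, G f = 0 → f = 0
  b_pos : 0 < b

namespace RankOneGap

variable {K G : E →L[ℂ] E} {ψ : E} {κ a b : ℝ} (h : RankOneGap K G ψ κ a b)
include h

theorem inner_pos {f : E} (hf : f ≠ 0) : 0 < (⟪G f, f⟫_ℂ).re := by
  by_contra hn
  have h1 := h.right_le f
  have h2 : ‖G f‖ ^ 2 ≤ 0 :=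
    h1.trans (mul_nonpos_of_nonneg_of_nonpos h.b_pos.le (not_lt.mp hn))
  have h3 : G f = 0 := by
    rw [← norm_eq_zero]; nlinarith [norm_nonneg (G f)]
  exact hf (h.right_injective f h3)

theorem norm_right_le : ‖G‖ ≤ b := by
  refine opNorm_le_bound _ h.b_pos.le fun f => ?_
  rcases (norm_nonneg (G f)).eq_or_lt' with h0 | h0
  · rw [h0]; exact mul_nonneg h.b_pos.le (norm_nonneg _)
  refine le_of_mul_le_mul_left ?_ h0
  calc ‖G f‖ * ‖G f‖ = ‖G f‖ ^ 2 := by ring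
    _ ≤ b * (⟪G f, f⟫_ℂ).re := h.right_le f
    _ ≤ b * (‖G f‖ * ‖f‖) := by
      gcongr
      · exact h.b_pos.le
      · exact (Complex.re_le_norm _).trans (norm_inner_le_norm _ _)
    _ = _ := by ring

/-- Subtracting from `K` its part along the eigenvector `ψ` leaves a positive `K'` of norm at most
`a`, so `μ - K' * G` is invertible for `μ` outside `[0, a * b]`. As `μ - K * G` differs from it by a
rank one operator, it can fail to be invertible only by having a kernel. -/
theorem exists_eigenvector {μ : ℂ} (hμ : μ ∈ spectrum ℂ (K * G))
    (hab : μ ∉ Complex.ofReal '' Set.Icc 0 (a * b)) : ∃ u, u ≠ 0 ∧ K (G u) = μ • u := by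
  set K' : E →L[ℂ] E := K - (κ : ℂ) • (((‖ψ‖ ^ 2 : ℝ) : ℂ)⁻¹ • (innerSL ℂ ψ).smulRight ψ) with hK'
  have hψ : ((‖ψ‖ ^ 2 : ℝ) : ℂ) ≠ 0 := by
    have := h.ne_zero
    exact_mod_cast pow_ne_zero 2 (norm_ne_zero_iff.mpr this)
  have hsym := inner_mul_left_of_nonneg h.nonneg_left
  -- decompose along `ψ`
  have key : ∀ x, ∃ (c : ℂ) (y : E), x = c • ψ + y ∧ ⟪ψ, y⟫_ℂ = 0 ∧ K' x = K y ∧ ‖y‖ ≤ ‖x‖ := by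
    intro x
    set c : ℂ := ((‖ψ‖ ^ 2 : ℝ) : ℂ)⁻¹ * ⟪ψ, x⟫_ℂ with hc
    have hy : ⟪ψ, x - c • ψ⟫_ℂ = 0 := by
      have hψψ : ⟪ψ, ψ⟫_ℂ = ((‖ψ‖ ^ 2 : ℝ) : ℂ) := by rw [inner_self_eq_norm_sq_to_K]; simp
      rw [inner_sub_right, inner_smul_right, hψψ, hc, mul_right_comm, inv_mul_cancel₀ hψ, one_mul,
        sub_self]
    refine ⟨c, x - c • ψ, by abel, hy, ?_, ?_⟩
    · simp only [hK', sub_apply, smul_apply, smulRight_apply, innerSL_apply_apply, map_sub, map_smul,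
        h.apply_eq, hc, smul_smul]
      congr 2
      ring
    · have e : ‖x‖ ^ 2 = ‖c • ψ‖ ^ 2 + ‖x - c • ψ‖ ^ 2 := by
        have := norm_add_sq_eq_norm_sq_add_norm_sq_of_inner_eq_zero (𝕜 := ℂ) (c • ψ) (x - c • ψ)
          (by rw [inner_smul_left, hy, mul_zero])
        rw [add_sub_cancel] at this
        nlinarith
      exact le_of_sq_le_sq (by nlinarith [sq_nonneg ‖c • ψ‖]) (norm_nonneg _)
  have hK'norm : ‖K'‖ ≤ a := by
    refine opNorm_le_bound _ h.a_nonneg fun x => ?_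
    obtain ⟨c, y, -, hy, hKx, hle⟩ := key x
    rw [hKx]
    exact (h.le_of_orthogonal y hy).trans (mul_le_mul_of_nonneg_left hle h.a_nonneg)
  have hKorth : ∀ y, ⟪ψ, y⟫_ℂ = 0 → ⟪ψ, K y⟫_ℂ = 0 := by
    intro y hy
    rw [← hsym, h.apply_eq, inner_smul_left, hy, mul_zero]
  have hK'0 : 0 ≤ K' := by
    rw [nonneg_iff_isPositive, isPositive_iff_complex]
    intro x
    obtain ⟨c, y, hx, hy, hKx, -⟩ := key x
    have e : ⟪K' x, x⟫_ℂ = ⟪K y, y⟫_ℂ := by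
      rw [hKx, hx, inner_add_right, inner_smul_right, ← inner_conj_symm, hKorth y hy]
      simp
    rw [e]
    exact isPositive_iff_complex K |>.mp ((nonneg_iff_isPositive K).mp h.nonneg_left) y
  have hunit : IsUnit (algebraMap ℂ (E →L[ℂ] E) μ - K' * G) := by
    by_contra hn
    obtain ⟨r, ⟨hr0, hr⟩, rfl⟩ := spectrum_mul_subset hK'0 h.nonneg_right (show μ ∈ _ from hn)
    exact hab ⟨r, ⟨hr0, hr.trans (mul_le_mul hK'norm h.norm_right_le (norm_nonneg _) h.a_nonneg)⟩,
      rfl⟩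
  obtain ⟨x, hx, hTx⟩ := exists_ker_of_not_isUnit_sub_rankOne
    (T := algebraMap ℂ (E →L[ℂ] E) μ - K * G) (w := ψ)
    (ℓ := ((κ : ℂ) * ((‖ψ‖ ^ 2 : ℝ) : ℂ)⁻¹) • (innerSL ℂ ψ ∘L G)) hunit (fun x => by
      change _ - K (G x) = _ - (K (G x) - (κ : ℂ) • ((‖ψ‖ ^ 2 : ℝ) : ℂ)⁻¹ • ⟪ψ, G x⟫_ℂ • ψ)
        - (((κ : ℂ) * ((‖ψ‖ ^ 2 : ℝ) : ℂ)⁻¹) • ⟪ψ, G x⟫_ℂ) • ψ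
      rw [smul_smul, smul_smul, smul_eq_mul, mul_assoc]
      abel) hμ
  refine ⟨x, hx, ?_⟩
  rw [sub_apply, sub_eq_zero, Algebra.algebraMap_eq_smul_one] at hTx
  exact hTx.symm

/-- In the inner product `⟪G u, u⟫` the operator `K * G` is symmetric; this bounds its Rayleigh
quotient by `a * b` on a hyperplane. The uniqueness lemmas below rest on the codimension being one.
-/
theorem inner_le_of_orthogonal {u : E} (hu : ⟪ψ, G u⟫_ℂ = 0) :
    (⟪K (G u), G u⟫_ℂ).re ≤ a * b * (⟪G u, u⟫_ℂ).re := by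
  calc _ ≤ ‖K (G u)‖ * ‖G u‖ := (Complex.re_le_norm _).trans (norm_inner_le_norm _ _)
    _ ≤ a * ‖G u‖ * ‖G u‖ := by gcongr; exact h.le_of_orthogonal _ hu
    _ = a * ‖G u‖ ^ 2 := by ring
    _ ≤ a * (b * (⟪G u, u⟫_ℂ).re) := mul_le_mul_of_nonneg_left (h.right_le u) h.a_nonneg
    _ = _ := by ring

theorem inner_ne_zero_of_eigenvector {u : E} {μ : ℝ} (hμ : a * b < μ) (hu0 : u ≠ 0)
    (hu : K (G u) = (μ : ℂ) • u) : ⟪ψ, G u⟫_ℂ ≠ 0 := by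
  intro h0
  have h1 := h.inner_le_of_orthogonal h0
  have hp := h.inner_pos hu0
  rw [hu, inner_smul_left, ← inner_mul_left_of_nonneg h.nonneg_right, Complex.conj_ofReal,
    Complex.re_ofReal_mul] at h1
  nlinarith

/-- Eigenvectors with distinct eigenvalues are orthogonal in the `G` form. Their span has dimension
two, so it meets the hyperplane `⟪ψ, G f⟫ = 0`, where the Rayleigh quotient is at most `a * b`; on
the span it exceeds `a * b`. -/
theorem eigenvalue_unique {u v : E} {μ ν : ℝ} (hμ : a * b < μ) (hν : a * b < ν) (hu0 : u ≠ 0)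
    (hv0 : v ≠ 0) (hu : K (G u) = (μ : ℂ) • u) (hv : K (G v) = (ν : ℂ) • v) : μ = ν := by
  by_contra hne
  have hsG := inner_mul_left_of_nonneg h.nonneg_right
  have hsK := inner_mul_left_of_nonneg h.nonneg_left
  have horth : ⟪G u, v⟫_ℂ = 0 := by
    have e : (μ : ℂ) * ⟪G u, v⟫_ℂ = ν * ⟪G u, v⟫_ℂ := by
      calc (μ : ℂ) * ⟪G u, v⟫_ℂ = ⟪K (G u), G v⟫_ℂ := by
            rw [hu, inner_smul_left, Complex.conj_ofReal, hsG]
        _ = ν * ⟪G u, v⟫_ℂ := by rw [hsK, hv, inner_smul_right]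
    have : ((μ : ℂ) - ν) * ⟪G u, v⟫_ℂ = 0 := by rw [sub_mul, e, sub_self]
    exact (mul_eq_zero.mp this).resolve_left (sub_ne_zero.mpr (by exact_mod_cast hne))
  have horth' : ⟪G v, u⟫_ℂ = 0 := by rw [hsG, ← inner_conj_symm, horth, map_zero]
  set c := ⟪ψ, G v⟫_ℂ
  set d := -⟪ψ, G u⟫_ℂ with hd
  have hc0 : c ≠ 0 := h.inner_ne_zero_of_eigenvector hν hv0 hv
  have h0 : ⟪ψ, G (c • u + d • v)⟫_ℂ = 0 := by
    rw [map_add, map_smul, map_smul, inner_add_right, inner_smul_right, inner_smul_right, hd]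
    ring
  have h1 := h.inner_le_of_orthogonal h0
  have e1 : (⟪G (c • u + d • v), c • u + d • v⟫_ℂ).re
      = ‖c‖ ^ 2 * (⟪G u, u⟫_ℂ).re + ‖d‖ ^ 2 * (⟪G v, v⟫_ℂ).re := by
    simp only [map_add, map_smul, inner_add_left, inner_add_right, inner_smul_left,
      inner_smul_right, horth, horth', mul_zero, add_zero, zero_add, Complex.add_re]
    rw [← mul_assoc, ← mul_assoc, Complex.mul_conj', Complex.mul_conj', ← Complex.ofReal_pow,
      ← Complex.ofReal_pow, Complex.re_ofReal_mul, Complex.re_ofReal_mul]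
  have e2 : (⟪K (G (c • u + d • v)), G (c • u + d • v)⟫_ℂ).re
      = ‖c‖ ^ 2 * (μ * (⟪G u, u⟫_ℂ).re) + ‖d‖ ^ 2 * (ν * (⟪G v, v⟫_ℂ).re) := by
    simp only [map_add, map_smul, inner_add_left, inner_add_right, inner_smul_left,
      inner_smul_right, hu, hv, ← hsG, horth, horth', mul_zero, add_zero, zero_add, Complex.add_re,
      Complex.conj_ofReal]
    rw [← mul_assoc c, ← mul_assoc d, Complex.mul_conj', Complex.mul_conj', ← Complex.ofReal_pow,
      ← Complex.ofReal_pow, Complex.re_ofReal_mul, Complex.re_ofReal_mul, Complex.re_ofReal_mul,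
      Complex.re_ofReal_mul]
  rw [e1, e2] at h1
  have p1 : 0 < ‖c‖ ^ 2 * (⟪G u, u⟫_ℂ).re :=
    mul_pos (pow_pos (norm_pos_iff.mpr hc0) 2) (h.inner_pos hu0)
  have p2 : 0 ≤ ‖d‖ ^ 2 * (⟪G v, v⟫_ℂ).re := mul_nonneg (by positivity) (h.inner_pos hv0).le
  nlinarith

/-- Some combination of the two eigenvectors lies in the hyperplane `⟪ψ, G f⟫ = 0`, which contains
no eigenvector for `μ`, so this combination vanishes. -/
theorem eigenvector_unique {u v : E} {μ : ℝ} (hμ : a * b < μ) (hu0 : u ≠ 0)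
    (hu : K (G u) = (μ : ℂ) • u) (hv : K (G v) = (μ : ℂ) • v) : ∃ c : ℂ, c • u = v := by
  have hd := h.inner_ne_zero_of_eigenvector hμ hu0 hu
  refine ⟨⟪ψ, G v⟫_ℂ / ⟪ψ, G u⟫_ℂ, ?_⟩
  by_contra hne
  refine h.inner_ne_zero_of_eigenvector (u := (⟪ψ, G v⟫_ℂ / ⟪ψ, G u⟫_ℂ) • u - v) hμ
    (sub_ne_zero.mpr hne) ?_ ?_
  · rw [map_sub, map_sub, map_smul, map_smul, hu, hv, smul_sub, smul_comm]
  · rw [map_sub, map_smul, inner_sub_right, inner_smul_right, div_mul_cancel₀ _ hd, sub_self]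

/-- Eigenvalues of `K * G` are semisimple. -/
theorem semisimple {w u : E} {μ : ℝ} (hw : K (G w) = (μ : ℂ) • w)
    (hu : K (G u) - (μ : ℂ) • u = w) : w = 0 := by
  by_contra hw0
  have hsG := inner_mul_left_of_nonneg h.nonneg_right
  have hsK := inner_mul_left_of_nonneg h.nonneg_left
  -- With `w = (K G - μ) u`, symmetry in the `G` form moves `K G - μ` onto `w`, where it vanishes.
  have e : ⟪G w, w⟫_ℂ = 0 := by
    nth_rw 2 [← hu]
    rw [inner_sub_right, ← hsK, hw, inner_smul_left, inner_smul_right, Complex.conj_ofReal, hsG,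
      sub_self]
  have := h.inner_pos hw0
  rw [e] at this
  simp at this

end RankOneGap

end PositiveProduct

/-! ### Unbounded operators with a bounded inverse. -/

namespace CahnHilliard

section Inverse

variable {X : Type*} [NormedAddCommGroup X] [NormedSpace ℂ X]

/-- `R` is a bounded two-sided inverse of the unbounded operator `T`. -/
structure IsBoundedInverse (T : X →ₗ.[ℂ] X) (R : X →L[ℂ] X) : Prop where
  left_inv : ∀ u : T.domain, R (T u) = u
  right_inv : ∀ f : X, ∃ u : T.domain, (u : X) = R f ∧ T u = f

namespace IsBoundedInverse

variable {S T : X →ₗ.[ℂ] X} {R Q : X →L[ℂ] X}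

theorem opMul (hS : IsBoundedInverse S Q) (hT : IsBoundedInverse T R) :
    IsBoundedInverse (opMul S T) (R * Q) where
  left_inv := by
    rintro ⟨u, hu, hu'⟩
    change R (Q (S ⟨T ⟨u, hu⟩, hu'⟩)) = u
    rw [hS.left_inv ⟨_, hu'⟩]
    exact hT.left_inv ⟨u, hu⟩
  right_inv f := by
    obtain ⟨v, hv, hSv⟩ := hS.right_inv f
    obtain ⟨u, hu, hTu⟩ := hT.right_inv v
    refine ⟨⟨u, u.2, ?_⟩, ?_, ?_⟩
    · rw [Subtype.coe_eta, hTu]; exact v.2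
    · change (u : X) = R (Q f)
      rw [hu, hv]
    · change S ⟨T u, _⟩ = f
      rw [← hSv]
      congr 1
      exact Subtype.ext hTu

theorem mem_domain (hT : IsBoundedInverse T R) (f : X) : R f ∈ T.domain := by
  obtain ⟨u, hu, -⟩ := hT.right_inv f
  rw [← hu]; exact u.2

theorem apply_apply (hT : IsBoundedInverse T R) (f : X) : T ⟨R f, hT.mem_domain f⟩ = f := by
  obtain ⟨u, hu, hTu⟩ := hT.right_inv f
  conv_rhs => rw [← hTu]
  congr 1
  exact Subtype.ext hu.symm

theorem injective (hT : IsBoundedInverse T R) {f : X} (hf : R f = 0) : f = 0 := by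
  have h1 := hT.apply_apply f
  have h2 : (⟨R f, hT.mem_domain f⟩ : T.domain) = 0 := Subtype.ext hf
  rw [← h1, h2, T.map_zero]

/-- Perturbation by a bounded operator `B` for which `1 + B R` is invertible. -/
theorem perturb (hT : IsBoundedInverse T R) {T' : X →ₗ.[ℂ] X} (hd : T'.domain = T.domain)
    {B : X →L[ℂ] X} (hB : ∀ (u : X) (h : u ∈ T.domain) (h' : u ∈ T'.domain),
      T' ⟨u, h'⟩ = T ⟨u, h⟩ + B u) (hu : IsUnit (1 + B * R)) :
    ∃ R', IsBoundedInverse T' R' := by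
  obtain ⟨q, hq⟩ := hu
  have e1 : ∀ f, (↑q⁻¹ : X →L[ℂ] X) (f + B (R f)) = f := by
    intro f
    have : (↑q⁻¹ : X →L[ℂ] X) * (1 + B * R) = 1 := by rw [← hq, Units.inv_mul]
    exact DFunLike.congr_fun this f
  have e2 : ∀ f, (↑q⁻¹ : X →L[ℂ] X) f + B (R ((↑q⁻¹ : X →L[ℂ] X) f)) = f := by
    intro f
    have : (1 + B * R) * (↑q⁻¹ : X →L[ℂ] X) = 1 := by rw [← hq, Units.mul_inv]
    exact DFunLike.congr_fun this f
  refine ⟨R * ↑q⁻¹, ⟨?_, fun f => ?_⟩⟩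
  · rintro ⟨u, hu⟩
    have hu' : u ∈ T.domain := hd ▸ hu
    change R ((↑q⁻¹ : X →L[ℂ] X) (T' ⟨u, hu⟩)) = u
    have h1 := hT.left_inv ⟨u, hu'⟩
    have h2 := e1 (T ⟨u, hu'⟩)
    rw [h1] at h2
    rw [hB u hu' hu, h2, h1]
  · have hm := hT.mem_domain ((↑q⁻¹ : X →L[ℂ] X) f)
    refine ⟨⟨R ((↑q⁻¹ : X →L[ℂ] X) f), hd ▸ hm⟩, rfl, ?_⟩
    rw [hB _ hm, hT.apply_apply, e2]

theorem perturb_of_norm_lt [CompleteSpace X] (hT : IsBoundedInverse T R) {T' : X →ₗ.[ℂ] X}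
    (hd : T'.domain = T.domain) {B : X →L[ℂ] X}
    (hB : ∀ (u : X) (h : u ∈ T.domain) (h' : u ∈ T'.domain), T' ⟨u, h'⟩ = T ⟨u, h⟩ + B u)
    (hn : ‖B‖ * ‖R‖ < 1) : ∃ R', IsBoundedInverse T' R' := by
  refine hT.perturb hd hB ?_
  have : ‖-(B * R)‖ < 1 := by rw [norm_neg]; exact (norm_mul_le _ _).trans_lt hn
  simpa using isUnit_one_sub_of_norm_lt_one this

theorem zero_mem_resolventSet (hT : IsBoundedInverse T R) : (0 : ℂ) ∈ resolventSet T := by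
  refine ⟨-R, fun u => ?_, fun f => ⟨⟨R (-f), hT.mem_domain _⟩, ?_, ?_⟩⟩
  · simp [hT.left_inv]
  · simp
  · rw [hT.apply_apply]; simp

/-- On the domain, `z - T = -z (z⁻¹ - R) T`, so the resolvent is `-z⁻¹ R (z⁻¹ - R)⁻¹`. -/
theorem mem_resolventSet (hT : IsBoundedInverse T R) {z : ℂ} (hz : z ≠ 0)
    (h : z⁻¹ ∉ _root_.spectrum ℂ R) : z ∈ resolventSet T := by
  obtain ⟨q, hq⟩ := _root_.spectrum.notMem_iff.mp h
  have hq' : ∀ f, (q : X →L[ℂ] X) f = z⁻¹ • f - R f := fun f => by rw [hq]; rfl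
  have e1 : ∀ f, (↑q⁻¹ : X →L[ℂ] X) (z⁻¹ • f - R f) = f := by
    intro f
    rw [← hq']
    exact DFunLike.congr_fun (Units.inv_mul q) f
  have e2 : ∀ f, z⁻¹ • (↑q⁻¹ : X →L[ℂ] X) f - R ((↑q⁻¹ : X →L[ℂ] X) f) = f := by
    intro f
    rw [← hq']
    exact DFunLike.congr_fun (Units.mul_inv q) f
  refine ⟨-z⁻¹ • (R * (↑q⁻¹ : X →L[ℂ] X)), fun u => ?_, fun f => ?_⟩
  · have h1 := hT.left_inv u
    have h2 : z • (u : X) - T u = -z • (z⁻¹ • T u - R (T u)) := by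
      rw [h1, smul_sub, smul_smul, neg_mul, mul_inv_cancel₀ hz]
      module
    change -z⁻¹ • R ((↑q⁻¹ : X →L[ℂ] X) (z • (u : X) - T u)) = u
    rw [h2, map_smul, e1, map_smul, h1, smul_smul, neg_mul_neg, inv_mul_cancel₀ hz, one_smul]
  · refine ⟨-z⁻¹ • ⟨R ((↑q⁻¹ : X →L[ℂ] X) f), hT.mem_domain _⟩, rfl, ?_⟩
    rw [T.map_smul, hT.apply_apply, Submodule.coe_smul, smul_smul, mul_neg, mul_inv_cancel₀ hz]
    conv_rhs => rw [← e2 f]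
    module

/-- The spectrum of `T` consists of inverses of points of the spectrum of its bounded inverse. -/
theorem inv_mem_spectrum (hT : IsBoundedInverse T R) {z : ℂ} (h : z ∈ spectrum T) :
    z ≠ 0 ∧ z⁻¹ ∈ _root_.spectrum ℂ R := by
  have hz : z ≠ 0 := by
    rintro rfl
    exact h hT.zero_mem_resolventSet
  refine ⟨hz, ?_⟩
  by_contra hn
  exact h (hT.mem_resolventSet hz hn)

theorem mem_eigenspace_iff (hT : IsBoundedInverse T R) {z : ℂ} (hz : z ≠ 0) {u : X} :
    u ∈ eigenspace T z ↔ R u = z⁻¹ • u := by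
  rw [mem_eigenspace]
  constructor
  · rintro ⟨h, hu⟩
    have := hT.left_inv ⟨u, h⟩
    rw [hu, map_smul] at this
    change z • R u = u at this
    rw [eq_inv_smul_iff₀ hz, this]
  · intro hu
    have hu' : R (z • u) = u := by rw [map_smul, hu, smul_inv_smul₀ hz]
    refine ⟨hu' ▸ hT.mem_domain _, ?_⟩
    have := hT.apply_apply (z • u)
    simpa only [hu'] using this

theorem mem_spectrum_of_eigenvector {z : ℂ} {u : X} (hu0 : u ≠ 0) (hu : u ∈ eigenspace T z) :
    z ∈ spectrum T := by
  rintro ⟨P, hP, -⟩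
  obtain ⟨h, hu⟩ := mem_eigenspace.mp hu
  have := hP ⟨u, h⟩
  rw [hu, sub_self, map_zero] at this
  exact hu0 this.symm

/-- If the bounded inverse has no Jordan block at `z⁻¹` then the generalized eigenspace at `z` is
the eigenspace. -/
theorem genEigenspace_eq (hT : IsBoundedInverse T R) {z : ℂ} (hz : z ≠ 0)
    (hss : ∀ w u, R w = z⁻¹ • w → R u - z⁻¹ • u = w → w = 0) :
    genEigenspace T z = eigenspace T z := by
  have h2 : kerPow T z 2 ≤ kerPow T z 1 := by
    rintro u ⟨h, hw⟩
    set w := T ⟨u, h⟩ - z • u with hwdef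
    have hRw : R w = z⁻¹ • w := (hT.mem_eigenspace_iff hz).mp hw
    have hRu : R w = u - z • R u := by
      rw [hwdef, map_sub, map_smul]
      congr 1
      exact hT.left_inv ⟨u, h⟩
    -- If `(T - z) u = w` and `(T - z) w = 0`, then `(R - z⁻¹) u = -z⁻² w`: a Jordan chain of `T`
    -- gives one of `R`.
    have h0 : -(z⁻¹ * z⁻¹) • w = 0 := by
      refine hss _ u ?_ ?_
      · rw [map_smul, hRw, smul_comm]
      · have e : R u = z⁻¹ • (u - z⁻¹ • w) := by
          rw [← hRw, hRu, sub_sub_cancel, inv_smul_smul₀ hz]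
        rw [e]
        module
    have hw0 : w = 0 := by
      rcases smul_eq_zero.mp h0 with h0 | h0
      · simp [hz] at h0
      · exact h0
    exact ⟨h, by rw [← hwdef, hw0]; exact Submodule.zero_mem _⟩
  have hle : ∀ n, kerPow T z n ≤ kerPow T z 1 := by
    intro n
    induction n with
    | zero => exact bot_le
    | succ n ih =>
      rintro u ⟨h, hw⟩
      exact h2 ⟨h, ih hw⟩
  exact le_antisymm (iSup_le hle) (le_iSup (kerPow T z) 1)

end IsBoundedInverse

end Inverse

theorem IsBoundedInverse.symmetric {X : Type*} [NormedAddCommGroup X] [InnerProductSpace ℂ X]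
    {T : X →ₗ.[ℂ] X} {R : X →L[ℂ] X} (hT : IsBoundedInverse T R)
    (hs : ∀ u v : T.domain, inner ℂ (T u) (v : X) = inner ℂ (u : X) (T v)) (f g : X) :
    inner ℂ (R f) g = inner ℂ f (R g) := by
  have := hs ⟨_, hT.mem_domain f⟩ ⟨_, hT.mem_domain g⟩
  rw [hT.apply_apply, hT.apply_apply] at this
  exact this.symm

theorem IsBoundedInverse.lower_bound {X : Type*} [NormedAddCommGroup X] [InnerProductSpace ℂ X]
    {T : X →ₗ.[ℂ] X} {R : X →L[ℂ] X} (hT : IsBoundedInverse T R) {c : ℝ}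
    (hc : ∀ u : T.domain, c * ‖(u : X)‖ ^ 2 ≤ (inner ℂ (u : X) (T u)).re) (f : X) :
    c * ‖R f‖ ^ 2 ≤ (inner ℂ (R f) f).re := by
  have := hc ⟨_, hT.mem_domain f⟩
  rwa [hT.apply_apply] at this

theorem norm_le_of_mul_norm_sq_le_inner {X : Type*} [NormedAddCommGroup X] [InnerProductSpace ℂ X]
    {c : ℝ} {x f : X} (h : c * ‖x‖ ^ 2 ≤ (inner ℂ x f).re) : c * ‖x‖ ≤ ‖f‖ := by
  rcases (norm_nonneg x).eq_or_lt' with h0 | h0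
  · rw [h0, mul_zero]; exact norm_nonneg _
  refine le_of_mul_le_mul_right ?_ h0
  calc c * ‖x‖ * ‖x‖ = c * ‖x‖ ^ 2 := by ring
    _ ≤ (inner ℂ x f).re := h
    _ ≤ ‖x‖ * ‖f‖ := (Complex.re_le_norm _).trans (norm_inner_le_norm _ _)
    _ = ‖f‖ * ‖x‖ := mul_comm _ _

theorem IsBoundedInverse.norm_le {X : Type*} [NormedAddCommGroup X] [InnerProductSpace ℂ X]
    {T : X →ₗ.[ℂ] X} {R : X →L[ℂ] X} (hT : IsBoundedInverse T R) {c : ℝ} (hc0 : 0 < c)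
    (hc : ∀ u : T.domain, c * ‖(u : X)‖ ^ 2 ≤ (inner ℂ (u : X) (T u)).re) : ‖R‖ ≤ c⁻¹ := by
  refine ContinuousLinearMap.opNorm_le_bound _ (by positivity) fun f => ?_
  rw [← div_eq_inv_mul, le_div_iff₀' hc0]
  exact norm_le_of_mul_norm_sq_le_inner (hT.lower_bound hc f)

/-- A symmetric operator with a nonnegative lower bound has a positive bounded inverse. -/
theorem IsBoundedInverse.nonneg {X : Type*} [NormedAddCommGroup X] [InnerProductSpace ℂ X]
    [CompleteSpace X] {T : X →ₗ.[ℂ] X} {R : X →L[ℂ] X} (hT : IsBoundedInverse T R) {c : ℝ}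
    (hc0 : 0 ≤ c) (hs : ∀ u v : T.domain, inner ℂ (T u) (v : X) = inner ℂ (u : X) (T v))
    (hc : ∀ u : T.domain, c * ‖(u : X)‖ ^ 2 ≤ (inner ℂ (u : X) (T u)).re) : 0 ≤ R := by
  rw [ContinuousLinearMap.nonneg_iff_isPositive]
  refine ⟨hT.symmetric hs, fun f => ?_⟩
  exact (mul_nonneg hc0 (sq_nonneg _)).trans (hT.lower_bound hc f)

end CahnHilliard

noncomputable section

namespace CahnHilliard

open MeasureTheory
open scoped Laplacian SchwartzMap ComplexConjugate

/-! ### Schwartz functions in the domain of `D k` -/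

theorem schwartz_laplacian_eq (φ : 𝓢(ℝ, ℂ)) :
    Δ φ = SchwartzMap.derivCLM ℂ ℂ (SchwartzMap.derivCLM ℂ ℂ φ) := by
  ext x
  simp [SchwartzMap.laplacian_apply, InnerProductSpace.laplacian_eq_iteratedDeriv_real,
    iteratedDeriv_succ, SchwartzMap.derivCLM_apply]
  rfl

/-- The embedding of Schwartz functions into `L²(ℝ)`. -/
def toL2 : 𝓢(ℝ, ℂ) →ₗ[ℂ] L2 := (SchwartzMap.toLpCLM ℂ ℂ 2 (volume : Measure ℝ)).toLinearMap

theorem toL2_apply (φ : 𝓢(ℝ, ℂ)) : toL2 φ = φ.toLp 2 := rfl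

theorem coeFn_toL2 (φ : 𝓢(ℝ, ℂ)) : toL2 φ =ᵐ[volume] φ := φ.coeFn_toLp 2

theorem denseRange_toL2 : DenseRange toL2 :=
  SchwartzMap.denseRange_toLpCLM (by simp)

theorem inner_toL2 (φ χ : 𝓢(ℝ, ℂ)) : inner ℂ (toL2 φ) (toL2 χ) = ∫ x, conj (φ x) * χ x := by
  rw [toL2_apply, toL2_apply]
  refine (SchwartzMap.inner_toL2_toL2_eq φ χ volume).trans ?_
  simp only [RCLike.inner_apply, mul_comm]

theorem toL2_distribution (φ : 𝓢(ℝ, ℂ)) :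
    ((toL2 φ : L2) : 𝓢'(ℝ, ℂ)) = φ.toTemperedDistributionCLM ℝ ℂ volume :=
  Lp.toTemperedDistribution_toLp_eq φ

/-- The operator `k² - ∂²` on Schwartz functions. -/
def schwartzD (k : ℝ) : 𝓢(ℝ, ℂ) →ₗ[ℂ] 𝓢(ℝ, ℂ) :=
  (k ^ 2 : ℂ) • LinearMap.id -
    (SchwartzMap.derivCLM ℂ ℂ ∘L SchwartzMap.derivCLM ℂ ℂ).toLinearMap

theorem schwartzD_eq (k : ℝ) (φ : 𝓢(ℝ, ℂ)) : schwartzD k φ = (k ^ 2 : ℂ) • φ - Δ φ := by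
  rw [schwartz_laplacian_eq]; rfl

theorem schwartzD_apply (k : ℝ) (φ : 𝓢(ℝ, ℂ)) (x : ℝ) :
    schwartzD k φ x = (k ^ 2 : ℂ) * φ x - deriv (deriv φ) x := rfl

theorem inner_schwartzD (k : ℝ) (φ χ : 𝓢(ℝ, ℂ)) :
    inner ℂ (toL2 (schwartzD k φ)) (toL2 χ) = inner ℂ (toL2 φ) (toL2 (schwartzD k χ)) := by
  have h : inner ℂ (toL2 (Δ φ)) (toL2 χ) = inner ℂ (toL2 φ) (toL2 (Δ χ)) := by
    rw [inner_toL2, inner_toL2]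
    exact (SchwartzMap.integral_bilinear_laplacian_right_eq_left φ χ
      ((ContinuousLinearMap.mul ℝ ℂ).comp (Complex.conjCLE : ℂ →L[ℝ] ℂ))).symm
  rw [schwartzD_eq, schwartzD_eq, map_sub, map_sub, map_smul, map_smul, inner_sub_left,
    inner_sub_right, h, inner_smul_left, inner_smul_right]
  simp

theorem schwartzD_lower_bound (k : ℝ) (φ : 𝓢(ℝ, ℂ)) :
    k ^ 2 * ‖toL2 φ‖ ^ 2 ≤ (inner ℂ (toL2 φ) (toL2 (schwartzD k φ))).re := by
  have h : (inner ℂ (toL2 φ) (toL2 (Δ φ))).re ≤ 0 := by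
    have e : inner ℂ (toL2 φ) (toL2 (Δ φ))
        = -inner ℂ (toL2 (SchwartzMap.derivCLM ℂ ℂ φ)) (toL2 (SchwartzMap.derivCLM ℂ ℂ φ)) := by
      rw [inner_toL2, inner_toL2, schwartz_laplacian_eq]
      exact SchwartzMap.integral_bilinear_deriv_right_eq_neg_left φ (SchwartzMap.derivCLM ℂ ℂ φ)
        ((ContinuousLinearMap.mul ℝ ℂ).comp (Complex.conjCLE : ℂ →L[ℝ] ℂ))
    rw [e, Complex.neg_re, neg_nonpos]
    exact inner_self_nonneg (𝕜 := ℂ)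
  have h2 : (inner ℂ (toL2 φ) (toL2 φ)).re = ‖toL2 φ‖ ^ 2 :=
    inner_self_eq_norm_sq (𝕜 := ℂ) _
  rw [schwartzD_eq, map_sub, map_smul, inner_sub_right, inner_smul_right, Complex.sub_re,
    ← Complex.ofReal_pow, Complex.re_ofReal_mul, h2]
  linarith

/-! ### Surjectivity on Schwartz functions -/

/-- The substitution `x ↦ 2πx/k` reduces the symbol to `k⁻² (1 + x²)⁻¹`. -/
theorem hasTemperateGrowth_inv_symbol {k : ℝ} (hk : 0 < k) :
    (fun x : ℝ => (k ^ 2 + (2 * Real.pi) ^ 2 * ‖x‖ ^ 2 : ℝ)⁻¹).HasTemperateGrowth := by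
  have h1 : (fun x : ℝ => (1 + ‖x‖ ^ 2 : ℝ) ^ (-1 : ℝ)).HasTemperateGrowth := by fun_prop
  have h2 : (fun x : ℝ => 2 * Real.pi / k * x).HasTemperateGrowth := by fun_prop
  have h3 := (Function.HasTemperateGrowth.const ((k ^ 2)⁻¹ : ℝ)).mul (h1.comp h2)
  refine (congrArg Function.HasTemperateGrowth (funext fun x => ?_)).mpr h3
  simp only [Function.comp, norm_mul, Pi.mul_apply]
  rw [Real.rpow_neg_one, ← mul_inv]
  congr 1
  rw [Real.norm_of_nonneg (by positivity : 0 ≤ 2 * Real.pi / k)]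
  field_simp

/-- On the Fourier side `k² - ∂²` is multiplication by `k² + (2π)² |x|²`, which vanishes nowhere,
and the multiplier by its reciprocal preserves Schwartz functions. -/
theorem exists_schwartz_inverse {k : ℝ} (hk : 0 < k) :
    ∃ N : 𝓢(ℝ, ℂ) →ₗ[ℂ] 𝓢(ℝ, ℂ), ∀ φ, schwartzD k (N φ) = φ := by
  set m : ℝ → ℝ := fun x => k ^ 2 + (2 * Real.pi) ^ 2 * ‖x‖ ^ 2 with hm
  have hmt : m.HasTemperateGrowth := by rw [hm]; fun_prop
  have hm0 : ∀ x, m x ≠ 0 := fun x => by rw [hm]; positivity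
  have hmi : (fun x => (m x)⁻¹).HasTemperateGrowth := hasTemperateGrowth_inv_symbol hk
  have hD : ∀ φ, schwartzD k φ = SchwartzMap.fourierMultiplierCLM ℂ m φ := by
    intro φ
    have h1 : m = (fun _ => k ^ 2) + ((2 * Real.pi) ^ 2) • (fun x : ℝ => ‖x‖ ^ 2) := by
      ext x; simp [hm]
    have hn : (fun x : ℝ => ‖x‖ ^ 2).HasTemperateGrowth := by fun_prop
    rw [schwartzD_eq, SchwartzMap.laplacian_eq_fourierMultiplierCLM, h1,
      SchwartzMap.fourierMultiplierCLM_apply (_ + _),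
      SchwartzMap.smulLeftCLM_add (by fun_prop) (by fun_prop), SchwartzMap.smulLeftCLM_smul hn]
    simp only [add_apply, smul_apply, SchwartzMap.smulLeftCLM_const,
      FourierTransform.fourierInv_add, FourierTransform.fourierInv_smul]
    rw [neg_smul, sub_neg_eq_add, SchwartzMap.fourierMultiplierCLM_apply]
    congr 1
    ext x
    simp
  refine ⟨(SchwartzMap.fourierMultiplierCLM ℂ (fun x => (((m x)⁻¹ : ℝ) : ℂ))).toLinearMap,
    fun φ => ?_⟩
  change schwartzD k (SchwartzMap.fourierMultiplierCLM ℂ (fun x => (((m x)⁻¹ : ℝ) : ℂ)) φ) = φ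
  have h2 : SchwartzMap.fourierMultiplierCLM ℂ (fun x => (((m x)⁻¹ : ℝ) : ℂ)) φ
      = SchwartzMap.fourierMultiplierCLM ℂ (fun x => (m x)⁻¹) φ :=
    SchwartzMap.fourierMultiplierCLM_ofReal ℂ hmi φ
  rw [h2, hD, SchwartzMap.fourierMultiplierCLM_fourierMultiplierCLM_apply hmt hmi]
  have h3 : (m * fun x => (m x)⁻¹) = fun _ => (1 : ℝ) := by
    ext x; exact mul_inv_cancel₀ (hm0 x)
  rw [h3, SchwartzMap.fourierMultiplierCLM_const]
  simp

theorem denseRange_toL2_schwartzD {k : ℝ} (hk : 0 < k) :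
    DenseRange fun φ : 𝓢(ℝ, ℂ) => toL2 (schwartzD k φ) := by
  obtain ⟨N, hN⟩ := exists_schwartz_inverse hk
  refine denseRange_toL2.mono ?_
  rintro _ ⟨φ, rfl⟩
  exact ⟨N φ, by simp only [hN]⟩

/-! ### The bounded inverse of `D k` -/

/-- The Bessel symbol is `1 + |x|²` while `-Δ` has symbol `(2π)² |x|²`, whence the constant. -/
theorem besselPotential_two (u : 𝓢'(ℝ, ℂ)) :
    TemperedDistribution.besselPotential ℝ ℂ 2 u
      = u - (((2 * Real.pi) ^ 2 : ℝ) : ℂ)⁻¹ • Δ u := by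
  have h1 : (fun x : ℝ => (((1 + ‖x‖ ^ 2) ^ ((2 : ℝ) / 2) : ℝ) : ℂ))
      = (fun _ => (1 : ℂ)) + fun x : ℝ => Complex.ofReal (‖x‖ ^ 2) := by
    ext x; simp
  rw [TemperedDistribution.laplacian_eq_fourierMultiplierCLM,
    TemperedDistribution.besselPotential, h1, TemperedDistribution.fourierMultiplierCLM_apply,
    TemperedDistribution.smulLeftCLM_add (by fun_prop) (by fun_prop)]
  simp only [add_apply, TemperedDistribution.smulLeftCLM_const,
      FourierTransform.fourierInv_add, FourierTransform.fourierInv_smul,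
      FourierTransform.fourierInv_fourier_eq]
  rw [← TemperedDistribution.fourierMultiplierCLM_apply, ← Complex.coe_smul (-(2 * Real.pi) ^ 2),
    smul_smul, sub_eq_add_neg, ← neg_smul, one_smul]
  congr 1
  have h2 : (((2 * Real.pi) ^ 2 : ℝ) : ℂ) ≠ 0 := by
    exact_mod_cast (by positivity : ((2 * Real.pi) ^ 2 : ℝ) ≠ 0)
  rw [Complex.ofReal_neg, mul_neg, neg_neg, inv_mul_cancel₀ h2, one_smul]

theorem mem_H2_of_laplacian {u f : L2} (h : Δ (u : 𝓢'(ℝ, ℂ)) = (f : 𝓢'(ℝ, ℂ))) : u ∈ H2 := by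
  refine ⟨u - (((2 * Real.pi) ^ 2 : ℝ) : ℂ)⁻¹ • f, ?_⟩
  rw [besselPotential_two, h, ← Lp.toTemperedDistributionCLM_apply,
    ← Lp.toTemperedDistributionCLM_apply, ← Lp.toTemperedDistributionCLM_apply, map_sub, map_smul]

theorem D_distribution (k : ℝ) (u : (D k).domain) :
    ((D k u : L2) : 𝓢'(ℝ, ℂ)) = (k ^ 2 : ℂ) • ((u : L2) : 𝓢'(ℝ, ℂ))
      - Δ ((u : L2) : 𝓢'(ℝ, ℂ)) := by
  have h : D k u = (k ^ 2 : ℂ) • (u : L2) + -secondDeriv u := rfl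
  rw [h, secondDeriv_spec u, ← Lp.toTemperedDistributionCLM_apply, map_add, map_neg, map_smul]
  rfl

theorem D_distribution_apply (k : ℝ) (u : (D k).domain) (φ : 𝓢(ℝ, ℂ)) :
    ((D k u : L2) : 𝓢'(ℝ, ℂ)) φ = ((u : L2) : 𝓢'(ℝ, ℂ)) (schwartzD k φ) := by
  rw [D_distribution, schwartzD_eq, map_sub, map_smul]
  change (k ^ 2 : ℂ) • ((u : L2) : 𝓢'(ℝ, ℂ)) φ - (Δ ((u : L2) : 𝓢'(ℝ, ℂ))) φ = _
  rw [TemperedDistribution.laplacian_apply_apply]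

/-- `schwartzD k` maps onto the Schwartz functions, so moving `D k` to the test function shows that
`D k u` determines `u` as a distribution. -/
theorem D_injective {k : ℝ} (hk : 0 < k) {u v : (D k).domain} (h : D k u = D k v) : u = v := by
  obtain ⟨N, hN⟩ := exists_schwartz_inverse hk
  apply Subtype.ext
  apply L2.toDistribution_injective
  ext φ
  rw [← hN φ, ← D_distribution_apply, ← D_distribution_apply, h]

/-- Weak solutions in `L²` are strong solutions: the weak equation already exhibits the Laplacian as
an `L²` function. -/
theorem exists_D_apply_eq {k : ℝ} {u f : L2}
    (h : ∀ φ, (u : 𝓢'(ℝ, ℂ)) (schwartzD k φ) = (f : 𝓢'(ℝ, ℂ)) φ) :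
    ∃ hu : u ∈ (D k).domain, D k ⟨u, hu⟩ = f := by
  have h1 : Δ (u : 𝓢'(ℝ, ℂ)) = (((k ^ 2 : ℂ) • u - f : L2) : 𝓢'(ℝ, ℂ)) := by
    ext φ
    rw [TemperedDistribution.laplacian_apply_apply,
      ← Lp.toTemperedDistributionCLM_apply (_ - _), map_sub, map_smul]
    change _ = (k ^ 2 : ℂ) • (u : 𝓢'(ℝ, ℂ)) φ - (f : 𝓢'(ℝ, ℂ)) φ
    rw [← h φ, schwartzD_eq, map_sub, map_smul, sub_sub_cancel]
  refine ⟨mem_H2_of_laplacian h1, ?_⟩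
  apply L2.toDistribution_injective
  ext φ
  rw [D_distribution_apply, h]

theorem toL2_mem_domain (k : ℝ) (φ : 𝓢(ℝ, ℂ)) :
    ∃ hu : toL2 φ ∈ (D k).domain, D k ⟨toL2 φ, hu⟩ = toL2 (schwartzD k φ) := by
  apply exists_D_apply_eq
  intro χ
  rw [schwartzD_eq, schwartzD_eq, map_sub, map_sub, map_smul, map_smul, toL2_distribution,
    ← TemperedDistribution.laplacian_apply_apply,
    TemperedDistribution.laplacian_toTemperedDistributionCLM_eq, ← toL2_distribution,
    ← toL2_distribution, ← Lp.toTemperedDistributionCLM_apply, ← Lp.toTemperedDistributionCLM_apply,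
    ← Lp.toTemperedDistributionCLM_apply, map_sub, map_smul]
  rfl

/-- The inverse on Schwartz functions is bounded by `k⁻²` in `L²`, hence extends by density. The
weak equation is a closed condition, so it survives the extension. -/
theorem exists_inverse_D {k : ℝ} (hk : 0 < k) : ∃ G : L2 →L[ℂ] L2, IsBoundedInverse (D k) G := by
  obtain ⟨N, hN⟩ := exists_schwartz_inverse hk
  have hb : ∀ φ, ‖(toL2 ∘ₗ N) φ‖ ≤ (k ^ 2)⁻¹ * ‖toL2 φ‖ := by
    intro φ
    rw [← div_eq_inv_mul, le_div_iff₀' (by positivity)]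
    have := norm_le_of_mul_norm_sq_le_inner (schwartzD_lower_bound k (N φ))
    rwa [hN] at this
  set G := (toL2 ∘ₗ N).extendOfNorm toL2 with hG
  have hGφ : ∀ φ, G (toL2 φ) = toL2 (N φ) := fun φ =>
    LinearMap.extendOfNorm_eq denseRange_toL2 ⟨_, hb⟩ φ
  have hright : ∀ f, ∃ hu : G f ∈ (D k).domain, D k ⟨G f, hu⟩ = f := by
    intro f
    apply exists_D_apply_eq
    intro χ
    have hc : ∀ η : 𝓢(ℝ, ℂ), Continuous fun u : L2 => (u : 𝓢'(ℝ, ℂ)) η := by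
      intro η
      have e : (fun u : L2 => (u : 𝓢'(ℝ, ℂ)) η)
          = fun u : L2 => (Lp.toTemperedDistributionCLM ℂ volume 2 u) η := rfl
      rw [e]
      fun_prop
    refine denseRange_toL2.induction_on (p := fun f => ((G f : L2) : 𝓢'(ℝ, ℂ)) (schwartzD k χ)
      = (f : 𝓢'(ℝ, ℂ)) χ) f ?_ ?_
    · exact isClosed_eq ((hc _).comp G.continuous) (hc _)
    · intro φ
      obtain ⟨hu, h⟩ := toL2_mem_domain k (N φ)
      rw [hGφ, ← D_distribution_apply k ⟨_, hu⟩, h, hN]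
  refine ⟨G, fun u => ?_, fun f => ?_⟩
  · obtain ⟨hu, h⟩ := hright (D k u)
    exact congrArg Subtype.val (D_injective hk h)
  · obtain ⟨hu, h⟩ := hright f
    exact ⟨⟨_, hu⟩, rfl, h⟩

/-- A closed property of `(u, D k u)` holds on the whole domain if it holds for Schwartz
functions. -/
theorem D_induction {k : ℝ} (hk : 0 < k) {p : L2 → L2 → Prop}
    (hp : IsClosed {q : L2 × L2 | p q.1 q.2})
    (h : ∀ φ : 𝓢(ℝ, ℂ), p (toL2 φ) (toL2 (schwartzD k φ))) (u : (D k).domain) :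
    p u (D k u) := by
  obtain ⟨G, hG⟩ := exists_inverse_D hk
  have key : ∀ f, p (G f) f := by
    intro f
    refine (denseRange_toL2_schwartzD hk).induction_on (p := fun f => p (G f) f) f ?_ ?_
    · exact hp.preimage (G.continuous.prodMk continuous_id)
    · intro φ
      obtain ⟨hu, hD⟩ := toL2_mem_domain k φ
      have : G (toL2 (schwartzD k φ)) = toL2 φ := by rw [← hD]; exact hG.left_inv ⟨_, hu⟩
      rw [this]
      exact h φ
  have := key (D k u)
  rwa [hG.left_inv] at this

theorem D_lower_bound {k : ℝ} (hk : 0 < k) (u : (D k).domain) :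
    k ^ 2 * ‖(u : L2)‖ ^ 2 ≤ (inner ℂ (u : L2) (D k u)).re :=
  D_induction hk (p := fun u f => k ^ 2 * ‖u‖ ^ 2 ≤ (inner ℂ u f).re)
    (isClosed_le (by fun_prop) (Complex.continuous_re.comp (by fun_prop)))
    (schwartzD_lower_bound k) u

theorem D_symmetric {k : ℝ} (hk : 0 < k) (u v : (D k).domain) :
    inner ℂ (D k u) (v : L2) = inner ℂ (u : L2) (D k v) := by
  refine D_induction hk (p := fun u f => inner ℂ f (v : L2) = inner ℂ u (D k v))
    (isClosed_eq (by fun_prop) (by fun_prop)) (fun φ => ?_) u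
  refine D_induction hk
    (p := fun v g => inner ℂ (toL2 (schwartzD k φ)) v = inner ℂ (toL2 φ) g)
    (isClosed_eq (by fun_prop) (by fun_prop)) (fun χ => ?_) v
  exact inner_schwartzD k φ χ

/-! ### The potential and the bounded inverse of `H k` -/

theorem coeFn_mulV (u : L2) : mulV u =ᵐ[volume] fun x => (V x : ℂ) * u x :=
  (memLp_V_mul u).coeFn_toLp

theorem norm_mulV_le (u : L2) : ‖mulV u‖ ≤ 3 / 2 * ‖u‖ := by
  refine Lp.norm_le_mul_norm_of_ae_le_mul ?_
  filter_upwards [coeFn_mulV u] with x hx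
  rw [hx, norm_mul]
  exact mul_le_mul_of_nonneg_right (norm_V_le x) (norm_nonneg _)

/-- Multiplication by `V` as a bounded operator. -/
def mulVCLM : L2 →L[ℂ] L2 := mulV.mkContinuous (3 / 2) norm_mulV_le

theorem mulVCLM_apply (u : L2) : mulVCLM u = mulV u := rfl

theorem norm_mulVCLM_le : ‖mulVCLM‖ ≤ 3 / 2 := mulV.mkContinuous_norm_le (by norm_num) _

theorem inner_mulV (u v : L2) : inner ℂ (mulV u) v = inner ℂ u (mulV v) := by
  rw [L2.inner_def, L2.inner_def]
  refine integral_congr_ae ?_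
  filter_upwards [coeFn_mulV u, coeFn_mulV v] with x hu hv
  rw [hu, hv]
  simp only [RCLike.inner_apply, map_mul, Complex.conj_ofReal]
  ring

theorem H_apply (k : ℝ) {u : L2} (hu : u ∈ (H k).domain) :
    H k ⟨u, hu⟩ = D k ⟨u, hu⟩ + (u + mulV u) := by
  rw [add_comm]; rfl

theorem D_shift (k l : ℝ) {u : L2} (hk : u ∈ (D k).domain) :
    D k ⟨u, hk⟩ = D l ⟨u, hk⟩ + (k ^ 2 - l ^ 2 : ℂ) • u := by
  change (k ^ 2 : ℂ) • u + -secondDeriv ⟨u, hk⟩ = (l ^ 2 : ℂ) • u + -secondDeriv ⟨u, hk⟩ + _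
  module

theorem H_symmetric {k : ℝ} (hk : 0 < k) (u v : (H k).domain) :
    inner ℂ (H k u) (v : L2) = inner ℂ (u : L2) (H k v) := by
  rw [H_apply k u.2, H_apply k v.2, inner_add_left, inner_add_left, inner_add_right,
    inner_add_right, inner_mulV]
  congr 1
  exact D_symmetric hk u v

/-- Positivity of `H₀` yields the bounded inverses of all the operators `H k`. -/
theorem exists_inverse_H (hpos : ∀ k : ℝ, 0 < k → ∀ u : (H k).domain,
      k ^ 2 * ‖(u : L2)‖ ^ 2 ≤ (inner ℂ (u : L2) (H k u)).re) {k : ℝ} (hk : 0 < k) :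
    ∃ K : L2 →L[ℂ] L2, IsBoundedInverse (H k) K := by
  -- Two Neumann series. `H l` equals `D l'` plus `V`, and `l' ^ 2 = k ^ 2 + 3` exceeds the bound
  -- `3/2` on `V`. Then `H k = H l - 2`, where the form bound gives an inverse of `H l` of norm at
  -- most `1 / (k ^ 2 + 2)`, just below `1/2`.
  set l := Real.sqrt (k ^ 2 + 2) with hl
  have hl2 : l ^ 2 = k ^ 2 + 2 := Real.sq_sqrt (by positivity)
  have hl0 : 0 < l := Real.sqrt_pos.mpr (by positivity)
  have hk2 : 0 < k ^ 2 := by positivity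
  set l' := Real.sqrt (l ^ 2 + 1) with hl'
  have hl'2 : l' ^ 2 = l ^ 2 + 1 := Real.sq_sqrt (by positivity)
  have hl'0 : 0 < l' := Real.sqrt_pos.mpr (by positivity)
  obtain ⟨G, hG⟩ := exists_inverse_D hl'0
  have hGn := hG.norm_le (by positivity) (D_lower_bound hl'0)
  obtain ⟨K', hK'⟩ := hG.perturb_of_norm_lt (T' := H l) (B := mulVCLM) rfl (fun u h h' => by
      rw [H_apply, D_shift l l' h, mulVCLM_apply, ← Complex.ofReal_pow, ← Complex.ofReal_pow, hl'2]
      push_cast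
      module) (by
    calc ‖mulVCLM‖ * ‖G‖ ≤ 3 / 2 * (l' ^ 2)⁻¹ := by gcongr; exact norm_mulVCLM_le
      _ < 1 := by
        rw [← div_eq_mul_inv, div_lt_one (by positivity)]
        linarith)
  have hKn := hK'.norm_le (by positivity) (hpos l hl0)
  refine hK'.perturb_of_norm_lt (T' := H k) (B := -(2 : ℂ) • ContinuousLinearMap.id ℂ L2) rfl
    (fun u h h' => ?_) ?_
  · rw [H_apply, H_apply, D_shift k l h, ← Complex.ofReal_pow, ← Complex.ofReal_pow, hl2]
    change _ = _ + -(2 : ℂ) • u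
    push_cast
    module
  · calc _ ≤ 2 * (l ^ 2)⁻¹ := by
          gcongr
          rw [norm_smul]
          calc ‖(-2 : ℂ)‖ * ‖ContinuousLinearMap.id ℂ L2‖ ≤ 2 * 1 := by
                gcongr
                · simp
                · exact ContinuousLinearMap.norm_id_le
            _ = 2 := by norm_num
      _ < 1 := by
        rw [← div_eq_mul_inv, div_lt_one (by positivity)]
        linarith

end CahnHilliard

end

noncomputable section

namespace CahnHilliard

open MeasureTheory Filter Topology
open scoped Laplacian SchwartzMap ComplexConjugate

/-! ### The ground state and the spectral gap of `-∂² + 1 + V` -/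

/-- The kink `tanh (x / 2)`. -/
def kink (x : ℝ) : ℝ := Real.sinh (x / 2) / Real.cosh (x / 2)

/-- The ground state `cosh (x / 2)⁻²` of `-∂² + 1 + V`. -/
def groundState (x : ℝ) : ℝ := (Real.cosh (x / 2) ^ 2)⁻¹

theorem V_eq (x : ℝ) : V x = -(3 / 2) * groundState x := rfl

theorem groundState_pos (x : ℝ) : 0 < groundState x := by
  have := Real.cosh_pos (x / 2)
  unfold groundState; positivity

theorem groundState_le_one (x : ℝ) : groundState x ≤ 1 :=
  inv_le_one_of_one_le₀ (one_le_pow₀ (Real.one_le_cosh _))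

theorem kink_sq (x : ℝ) : kink x ^ 2 = 1 - groundState x := by
  have := (Real.cosh_pos (x / 2)).ne'
  rw [kink, groundState, div_pow, Real.sinh_sq]
  field_simp

theorem abs_kink_le_one (x : ℝ) : |kink x| ≤ 1 := by
  rw [← sq_le_one_iff_abs_le_one, kink_sq]
  linarith [groundState_pos x]

theorem hasDerivAt_kink (x : ℝ) : HasDerivAt kink (groundState x / 2) x := by
  have h := (Real.cosh_pos (x / 2)).ne'
  have h1 : HasDerivAt (fun y : ℝ => y / 2) (1 / 2) x := (hasDerivAt_id x).div_const 2
  refine (h1.sinh.div h1.cosh h).congr_deriv ?_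
  rw [groundState]
  field_simp
  rw [Real.sinh_sq]
  ring

theorem hasDerivAt_groundState (x : ℝ) :
    HasDerivAt groundState (-(kink x * groundState x)) x := by
  have h := (Real.cosh_pos (x / 2)).ne'
  have h1 : HasDerivAt (fun y : ℝ => y / 2) (1 / 2) x := (hasDerivAt_id x).div_const 2
  refine ((h1.cosh.pow 2).inv (pow_ne_zero 2 h)).congr_deriv ?_
  rw [groundState, kink]
  simp only [Pi.pow_apply]
  field_simp
  push_cast
  ring

theorem continuous_kink : Continuous kink :=
  continuous_iff_continuousAt.mpr fun x => (hasDerivAt_kink x).continuousAt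

theorem continuous_groundState : Continuous groundState :=
  continuous_iff_continuousAt.mpr fun x => (hasDerivAt_groundState x).continuousAt

theorem groundState_le (x : ℝ) : groundState x ≤ (1 + (x / 2) ^ 2)⁻¹ := by
  unfold groundState
  gcongr
  rw [Real.cosh_sq', add_le_add_iff_left, ← sq_abs (x / 2), ← sq_abs (Real.sinh _),
    Real.abs_sinh]
  gcongr
  exact Real.self_le_sinh_iff.mpr (abs_nonneg _)

theorem integrable_groundState : Integrable groundState := by
  have h : Integrable fun x : ℝ => (1 + (x / 2) ^ 2)⁻¹ :=
    integrable_inv_one_add_sq.comp_div (by norm_num : (2 : ℝ) ≠ 0)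
  refine h.mono' continuous_groundState.aestronglyMeasurable (Eventually.of_forall fun x => ?_)
  rw [Real.norm_of_nonneg (groundState_pos x).le]
  exact groundState_le x

theorem tendsto_groundState : Tendsto groundState (cocompact ℝ) (𝓝 0) := by
  have h : Tendsto (fun x : ℝ => (1 + (x / 2) ^ 2)⁻¹) (cocompact ℝ) (𝓝 0) := by
    apply Tendsto.inv_tendsto_atTop
    apply tendsto_atTop_add_const_left
    have h1 : Tendsto (fun x : ℝ => (‖x‖ / 2) ^ 2) (cocompact ℝ) atTop :=
      (tendsto_pow_atTop two_ne_zero).comp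
        ((tendsto_norm_cocompact_atTop (E := ℝ)).atTop_div_const (by norm_num : (0 : ℝ) < 2))
    refine h1.congr fun x => ?_
    rw [div_pow, div_pow, Real.norm_eq_abs, sq_abs]
  exact squeeze_zero (fun x => (groundState_pos x).le) groundState_le h

theorem memLp_groundState : MemLp groundState 2 := by
  rw [memLp_two_iff_integrable_sq continuous_groundState.aestronglyMeasurable]
  refine integrable_groundState.mono' (continuous_groundState.pow 2).aestronglyMeasurable
    (Eventually.of_forall fun x => ?_)
  have h0 := groundState_pos x
  have h1 := groundState_le_one x
  rw [Real.norm_of_nonneg (by positivity)]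
  nlinarith

theorem integral_groundState_sq_pos : 0 < ∫ x, groundState x ^ 2 := by
  exact integral_pos_of_integrable_nonneg_nonzero (x := 0) (continuous_groundState.pow 2)
    memLp_groundState.integrable_sq (fun x => sq_nonneg _) (pow_pos (groundState_pos 0) 2).ne'

/-- Since `kink² = 1 - groundState → 1`, passing through squares avoids the differing signs of
`kink` at the two ends. -/
theorem tendsto_div_kink {g : ℝ → ℝ} {l : Filter ℝ} (hl : l ≤ cocompact ℝ)
    (hg : Tendsto g l (𝓝 0)) : Tendsto (fun x => g x / kink x) l (𝓝 0) := by
  have h1 : Tendsto (fun x => 1 - groundState x) l (𝓝 (1 - 0)) :=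
    tendsto_const_nhds.sub (tendsto_groundState.mono_left hl)
  have h2 : Tendsto (fun x => (g x) ^ 2 / (1 - groundState x)) l (𝓝 (0 ^ 2 / (1 - 0))) :=
    (hg.pow 2).div h1 (by norm_num)
  have h3 := h2.sqrt
  simp only [ne_eq, OfNat.ofNat_ne_zero, not_false_eq_true, zero_pow, zero_div, Real.sqrt_zero]
    at h3
  rw [tendsto_zero_iff_abs_tendsto_zero]
  refine h3.congr fun x => ?_
  rw [← kink_sq, ← div_pow, Real.sqrt_sq_eq_abs]
  rfl

theorem eventually_kink_ne_zero {l : Filter ℝ} (hl : l ≤ cocompact ℝ) :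
    ∀ᶠ x in l, kink x ≠ 0 := by
  have h := (tendsto_groundState.mono_left hl).eventually (gt_mem_nhds (zero_lt_one (α := ℝ)))
  filter_upwards [h] with x hx h0
  have := kink_sq x
  rw [h0] at this
  linarith

/-- The Poincaré type inequality behind the spectral gap `3/4`. -/
theorem gap_of_orthogonal {g g' : ℝ → ℝ} (hd : ∀ x, HasDerivAt g (g' x) x)
    (h0 : Tendsto g (cocompact ℝ) (𝓝 0)) (hg : MemLp g 2)
    (hL : MemLp (fun x => g' x + kink x * g x) 2) (horth : ∫ x, groundState x * g x = 0) :
    3 / 4 * ∫ x, g x ^ 2 ≤ ∫ x, (g' x + kink x * g x) ^ 2 := by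
  have hgc : Continuous g := continuous_iff_continuousAt.mpr fun x => (hd x).continuousAt
  have hi : Integrable fun x => groundState x * g x := memLp_groundState.integrable_mul hg
  have hc : Continuous fun x => groundState x * g x := continuous_groundState.mul hgc
  set I : ℝ → ℝ := fun x => (∫ y in Set.Ioi 0, groundState y * g y)
    - ∫ y in (0 : ℝ)..x, groundState y * g y with hI
  have hId : ∀ x, HasDerivAt I (-(groundState x * g x)) x := fun x => by
    have := (hc.integral_hasStrictDerivAt 0 x).hasDerivAt.const_sub
      (∫ y in Set.Ioi 0, groundState y * g y)
    exact this
  have hItop : Tendsto I atTop (𝓝 0) := by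
    have := (intervalIntegral_tendsto_integral_Ioi (0 : ℝ) hi.integrableOn tendsto_id).const_sub
      (∫ y in Set.Ioi 0, groundState y * g y)
    rwa [sub_self] at this
  -- `I x` is the integral of `groundState * g` over `(x, ∞)`; orthogonality to the ground state
  -- makes it vanish at `-∞` too.
  have hIbot : Tendsto I atBot (𝓝 0) := by
    have h1 := (intervalIntegral_tendsto_integral_Iic (0 : ℝ) hi.integrableOn tendsto_id).const_add
      (∫ y in Set.Ioi 0, groundState y * g y)
    have h2 : (∫ y in Set.Ioi 0, groundState y * g y) + ∫ y in Set.Iic 0, groundState y * g y = 0 := by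
      rw [add_comm, intervalIntegral.integral_Iic_add_Ioi hi.integrableOn hi.integrableOn, horth]
    rw [h2] at h1
    refine h1.congr fun x => ?_
    rw [hI]
    simp only [id]
    rw [intervalIntegral.integral_symm x 0]
    ring
  have hquot : ∀ x, -(groundState x * g x) / -(kink x * groundState x) = g x / kink x := by
    intro x
    have := (groundState_pos x).ne'
    rw [neg_div_neg_eq, mul_comm (kink x), mul_div_mul_left _ _ this]
  have hne : ∀ l ≤ cocompact ℝ, ∀ᶠ x in l, -(kink x * groundState x) ≠ 0 := by
    intro l hl
    filter_upwards [eventually_kink_ne_zero hl] with x hx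
    exact neg_ne_zero.mpr (mul_ne_zero hx (groundState_pos x).ne')
  -- `v` is the decaying solution of `A* v = g`, where `A* = -∂ + kink`; its limits at both ends
  -- come from l'Hôpital's rule.
  set v : ℝ → ℝ := fun x => I x / groundState x with hv
  have hvd : ∀ x, HasDerivAt v (-g x + kink x * v x) x := by
    intro x
    have h := (groundState_pos x).ne'
    refine ((hId x).div (hasDerivAt_groundState x) h).congr_deriv ?_
    rw [hv]
    field_simp
    ring
  have hvtop : Tendsto v atTop (𝓝 0) := by
    refine HasDerivAt.lhopital_zero_atTop (Eventually.of_forall hId)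
      (Eventually.of_forall hasDerivAt_groundState) (hne _ atTop_le_cocompact) hItop
      (tendsto_groundState.mono_left atTop_le_cocompact) ?_
    simp only [hquot]
    exact tendsto_div_kink atTop_le_cocompact (h0.mono_left atTop_le_cocompact)
  have hvbot : Tendsto v atBot (𝓝 0) := by
    refine HasDerivAt.lhopital_zero_atBot (Eventually.of_forall hId)
      (Eventually.of_forall hasDerivAt_groundState) (hne _ atBot_le_cocompact) hIbot
      (tendsto_groundState.mono_left atBot_le_cocompact) ?_
    simp only [hquot]
    exact tendsto_div_kink atBot_le_cocompact (h0.mono_left atBot_le_cocompact)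
  -- `Q` collects the boundary terms in `‖A g‖² - 3/4 ‖g‖² = ‖A g - 3/4 v‖² + 3/4 ‖B v‖²`. Here `B =
  -- ∂ + kink / 2` annihilates `cosh(x/2)⁻¹`, the ground state of `AA*` with eigenvalue `3/4`, and
  -- `B v = -g + (3/2) kink v`.
  set Q : ℝ → ℝ := fun x => 3 / 2 * (g x * v x) - 9 / 8 * (kink x * v x ^ 2) with hQ
  set Q' : ℝ → ℝ := fun x => 3 / 2 * (g' x * v x + g x * (-g x + kink x * v x))
    - 9 / 8 * (groundState x / 2 * v x ^ 2 + kink x * (2 * v x * (-g x + kink x * v x))) with hQ'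
  have hQd : ∀ x, HasDerivAt Q (Q' x) x := by
    intro x
    refine ((((hd x).mul (hvd x)).const_mul (3 / 2)).sub
      (((hasDerivAt_kink x).mul ((hvd x).pow 2)).const_mul (9 / 8))).congr_deriv ?_
    simp [hQ']
  have hQlim : ∀ l ≤ cocompact ℝ, Tendsto v l (𝓝 0) → Tendsto Q l (𝓝 0) := by
    intro l hl hvl
    have h1 : Tendsto (fun x => g x * v x) l (𝓝 (0 * 0)) := (h0.mono_left hl).mul hvl
    have h2 : Tendsto (fun x => kink x * v x ^ 2) l (𝓝 0) := by
      refine squeeze_zero_norm (a := fun x => v x ^ 2) (fun x => ?_) (by simpa using hvl.pow 2)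
      rw [norm_mul, Real.norm_eq_abs, Real.norm_eq_abs, abs_pow, sq_abs]
      exact mul_le_of_le_one_left (sq_nonneg _) (abs_kink_le_one x)
    have := (h1.const_mul (3 / 2)).sub (h2.const_mul (9 / 8))
    simpa using this
  have hle : ∀ x, Q' x ≤ (g' x + kink x * g x) ^ 2 - 3 / 4 * g x ^ 2 := by
    intro x
    have hk := kink_sq x
    have hs : groundState x = 1 - kink x ^ 2 := by linarith
    have e : (g' x + kink x * g x) ^ 2 - 3 / 4 * g x ^ 2 - Q' x
        = (g' x + kink x * g x - 3 / 4 * v x) ^ 2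
          + 3 / 4 * (-g x + 3 / 2 * (kink x * v x)) ^ 2 := by
      simp only [hQ', hs]
      ring
    nlinarith [sq_nonneg (g' x + kink x * g x - 3 / 4 * v x),
      sq_nonneg (-g x + 3 / 2 * (kink x * v x))]
  have hFi : Integrable fun x => (g' x + kink x * g x) ^ 2 - 3 / 4 * g x ^ 2 :=
    hL.integrable_sq.sub (hg.integrable_sq.const_mul _)
  have hlim := intervalIntegral_tendsto_integral hFi tendsto_neg_atTop_atBot tendsto_id
  have hQt : Tendsto (fun x => Q x - Q (-x)) atTop (𝓝 (0 - 0)) :=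
    (hQlim _ atTop_le_cocompact hvtop).sub
      ((hQlim _ atBot_le_cocompact hvbot).comp tendsto_neg_atTop_atBot)
  -- Only the upper bound for `Q'` is integrated, so no integrability of `v ^ 2` or of `Q'` is
  -- needed.
  have hfin : 0 - 0 ≤ ∫ x, (g' x + kink x * g x) ^ 2 - 3 / 4 * g x ^ 2 := by
    refine le_of_tendsto_of_tendsto hQt hlim ?_
    filter_upwards [eventually_ge_atTop 0] with x hx
    exact intervalIntegral.sub_le_integral_of_hasDeriv_right_of_le (by linarith)
      (fun y _ => (hQd y).continuousAt.continuousWithinAt)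
      (fun y _ => (hQd y).hasDerivWithinAt) hFi.integrableOn (fun y _ => hle y)
  rw [integral_sub hL.integrable_sq (hg.integrable_sq.const_mul _), integral_const_mul] at hfin
  linarith

theorem memLp_mul_of_abs_le_one {f g : ℝ → ℝ} (hf : Continuous f) (hf1 : ∀ x, |f x| ≤ 1)
    (hg : MemLp g 2) : MemLp (fun x => f x * g x) 2 :=
  MemLp.of_le hg (hf.aestronglyMeasurable.mul hg.aestronglyMeasurable)
    (Eventually.of_forall fun x => by
      rw [norm_mul]
      exact mul_le_of_le_one_left (norm_nonneg _) (hf1 x))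

theorem abs_groundState_le_one (x : ℝ) : |groundState x| ≤ 1 := by
  rw [abs_of_pos (groundState_pos x)]; exact groundState_le_one x

theorem integrable_form (a : 𝓢(ℝ, ℝ)) :
    Integrable fun x => a x * (-deriv (deriv a) x + a x + V x * a x) := by
  have m0 : MemLp a 2 := a.memLp 2
  have m2 : MemLp (fun x => deriv (deriv a) x) 2 := by
    have h : MemLp (SchwartzMap.derivCLM ℝ ℝ (SchwartzMap.derivCLM ℝ ℝ a)) 2 volume :=
      (SchwartzMap.derivCLM ℝ ℝ (SchwartzMap.derivCLM ℝ ℝ a)).memLp 2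
    exact h
  have mg : MemLp (fun x => groundState x * a x) 2 :=
    memLp_mul_of_abs_le_one continuous_groundState abs_groundState_le_one m0
  refine m0.integrable_mul (q := 2) (g := fun x => -deriv (deriv a) x + a x + V x * a x) ?_
  refine (m2.neg.add m0).add ?_
  have := mg.const_mul (-(3 / 2))
  simp only [← mul_assoc] at this
  exact this

/-- Factorization of the quadratic form of `-∂² + 1 + V`. -/
theorem integral_form_eq (a : 𝓢(ℝ, ℝ)) :
    ∫ x, a x * (-deriv (deriv a) x + a x + V x * a x)
      = ∫ x, (deriv a x + kink x * a x) ^ 2 := by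
  set a' := SchwartzMap.derivCLM ℝ ℝ a with ha'
  set a'' := SchwartzMap.derivCLM ℝ ℝ a' with ha''
  have hd : ∀ x, HasDerivAt a (a' x) x := a.hasDerivAt
  have hd' : ∀ x, HasDerivAt a' (a'' x) x := a'.hasDerivAt
  change ∫ x, a x * (-a'' x + a x + V x * a x) = ∫ x, (a' x + kink x * a x) ^ 2
  have m0 : MemLp a 2 := a.memLp 2
  have m1 : MemLp a' 2 := a'.memLp 2
  have mk : MemLp (fun x => kink x * a x) 2 :=
    memLp_mul_of_abs_le_one continuous_kink abs_kink_le_one m0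
  have hi1 : Integrable fun x => (a' x + kink x * a x) ^ 2 := (m1.add mk).integrable_sq
  have hi2 : Integrable fun x => a x * (-a'' x + a x + V x * a x) := integrable_form a
  -- The two integrands differ by an exact derivative, because `kink' = groundState / 2` and `kink²
  -- = 1 - groundState`.
  have hder : ∀ x, HasDerivAt (fun x => a x * a' x + kink x * a x ^ 2)
      ((a' x + kink x * a x) ^ 2 - a x * (-a'' x + a x + V x * a x)) x := by
    intro x
    refine (((hd x).mul (hd' x)).add ((hasDerivAt_kink x).mul ((hd x).pow 2))).congr_deriv ?_
    have := kink_sq x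
    rw [V_eq, show groundState x = 1 - kink x ^ 2 by linarith]
    simp
    ring
  have hlim : Tendsto (fun x => a x * a' x + kink x * a x ^ 2) (cocompact ℝ) (𝓝 0) := by
    have h0 : Tendsto a (cocompact ℝ) (𝓝 0) := a.tendsto_cocompact
    have h1 : Tendsto a' (cocompact ℝ) (𝓝 0) := a'.tendsto_cocompact
    have h2 : Tendsto (fun x => kink x * a x ^ 2) (cocompact ℝ) (𝓝 0) := by
      refine squeeze_zero_norm (a := fun x => a x ^ 2) (fun x => ?_) (by simpa using h0.pow 2)
      rw [norm_mul, Real.norm_eq_abs, Real.norm_eq_abs, abs_pow, sq_abs]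
      exact mul_le_of_le_one_left (sq_nonneg _) (abs_kink_le_one x)
    simpa using (h0.mul h1).add h2
  have := integral_of_hasDerivAt_of_tendsto hder (hi1.sub hi2)
    (hlim.mono_left atBot_le_cocompact) (hlim.mono_left atTop_le_cocompact)
  rw [integral_sub hi1 hi2] at this
  linarith

/-- `∂ + kink` kills the ground state, so removing the projection of `a` onto it leaves the form
unchanged and makes `gap_of_orthogonal` applicable. -/
theorem gap_schwartz (a : 𝓢(ℝ, ℝ)) :
    3 / 4 * ∫ x, (a x - (∫ y, groundState y * a y) / (∫ y, groundState y ^ 2) * groundState x) ^ 2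
      ≤ ∫ x, a x * (-deriv (deriv a) x + a x + V x * a x) := by
  rw [integral_form_eq]
  set c := (∫ y, groundState y * a y) / (∫ y, groundState y ^ 2) with hc
  have m0 : MemLp a 2 := a.memLp 2
  have m1 : MemLp (fun x => deriv a x) 2 := by
    have h : MemLp (SchwartzMap.derivCLM ℝ ℝ a) 2 volume := (SchwartzMap.derivCLM ℝ ℝ a).memLp 2
    exact h
  have mk : MemLp (fun x => kink x * a x) 2 :=
    memLp_mul_of_abs_le_one continuous_kink abs_kink_le_one m0
  have mc : MemLp (fun x => c * groundState x) 2 := memLp_groundState.const_mul c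
  have e : ∀ x, deriv a x - c * -(kink x * groundState x) + kink x * (a x - c * groundState x)
      = deriv a x + kink x * a x := fun x => by ring
  have h := gap_of_orthogonal (g := fun x => a x - c * groundState x)
    (g' := fun x => deriv a x - c * -(kink x * groundState x))
    (fun x => (a.hasDerivAt x).sub ((hasDerivAt_groundState x).const_mul c))
    (by
      have h0 : Tendsto a (cocompact ℝ) (𝓝 0) := a.tendsto_cocompact
      simpa using h0.sub (tendsto_groundState.const_mul c))
    (m0.sub mc) (by simp only [e]; exact m1.add mk)
    (by
      have i1 : Integrable fun x => groundState x * a x := memLp_groundState.integrable_mul m0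
      have i2 : Integrable fun x => c * groundState x ^ 2 :=
        memLp_groundState.integrable_sq.const_mul c
      have : ∀ x, groundState x * (a x - c * groundState x)
          = groundState x * a x - c * groundState x ^ 2 := fun x => by ring
      simp only [this]
      rw [integral_sub i1 i2, integral_const_mul, hc,
        div_mul_cancel₀ _ integral_groundState_sq_pos.ne', sub_self])
  simpa only [e] using h

end CahnHilliard

end

/-! ### The ground state and the gap in the complex space `L²(ℝ)`. -/

noncomputable section

namespace CahnHilliard

open MeasureTheory Filter Topology
open scoped Laplacian SchwartzMap ComplexConjugate

theorem memLp_ofReal_groundState : MemLp (fun x => (groundState x : ℂ)) 2 volume :=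
  memLp_groundState.ofReal

/-- The ground state as an element of `L²(ℝ)`. -/
def groundL2 : L2 := memLp_ofReal_groundState.toLp _

theorem coeFn_groundL2 : groundL2 =ᵐ[volume] fun x => (groundState x : ℂ) :=
  memLp_ofReal_groundState.coeFn_toLp

theorem norm_sq_eq_integral (u : L2) : ‖u‖ ^ 2 = ∫ x, ‖u x‖ ^ 2 := by
  have h : (inner ℂ u u).re = ‖u‖ ^ 2 := inner_self_eq_norm_sq (𝕜 := ℂ) _
  rw [← h, L2.inner_def, ← RCLike.re_eq_complex_re, ← integral_re (L2.integrable_inner u u)]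
  simp only [inner_self_eq_norm_sq]

theorem norm_groundL2_sq : ‖groundL2‖ ^ 2 = ∫ x, groundState x ^ 2 := by
  rw [norm_sq_eq_integral]
  refine integral_congr_ae ?_
  filter_upwards [coeFn_groundL2] with x hx
  rw [hx, Complex.norm_real, Real.norm_eq_abs, sq_abs]

theorem groundL2_ne_zero : groundL2 ≠ 0 := by
  intro h
  have h1 := norm_groundL2_sq
  have h2 := integral_groundState_sq_pos
  rw [h] at h1
  simp at h1
  linarith

theorem inner_groundL2 (φ : 𝓢(ℝ, ℂ)) :
    inner ℂ groundL2 (toL2 φ) = ∫ x, (groundState x : ℂ) * φ x := by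
  rw [L2.inner_def]
  refine integral_congr_ae ?_
  filter_upwards [coeFn_groundL2, coeFn_toL2 φ] with x hx hx'
  rw [hx, hx', RCLike.inner_apply, Complex.conj_ofReal, mul_comm]

theorem integrable_groundState_mul (φ : 𝓢(ℝ, ℂ)) :
    Integrable fun x => (groundState x : ℂ) * φ x :=
  memLp_ofReal_groundState.integrable_mul (φ.memLp 2)

/-- The real part of a Schwartz function. -/
def schwartzRe (φ : 𝓢(ℝ, ℂ)) : 𝓢(ℝ, ℝ) := φ.postcompCLM Complex.reCLM

/-- The imaginary part of a Schwartz function. -/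
def schwartzIm (φ : 𝓢(ℝ, ℂ)) : 𝓢(ℝ, ℝ) := φ.postcompCLM Complex.imCLM

theorem schwartzRe_apply (φ : 𝓢(ℝ, ℂ)) (x : ℝ) : schwartzRe φ x = (φ x).re := rfl

theorem schwartzIm_apply (φ : 𝓢(ℝ, ℂ)) (x : ℝ) : schwartzIm φ x = (φ x).im := rfl

theorem deriv_schwartzRe (φ : 𝓢(ℝ, ℂ)) :
    deriv (schwartzRe φ) = schwartzRe (SchwartzMap.derivCLM ℂ ℂ φ) :=
  funext fun x => (Complex.reCLM.hasFDerivAt.comp_hasDerivAt x (φ.hasDerivAt x)).deriv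

theorem deriv_schwartzIm (φ : 𝓢(ℝ, ℂ)) :
    deriv (schwartzIm φ) = schwartzIm (SchwartzMap.derivCLM ℂ ℂ φ) :=
  funext fun x => (Complex.imCLM.hasFDerivAt.comp_hasDerivAt x (φ.hasDerivAt x)).deriv

/-- The action of `-∂² + 1 + V` on a Schwartz function. -/
theorem coeFn_schwartzD_add_mulV (φ : 𝓢(ℝ, ℂ)) :
    (toL2 (schwartzD 1 φ) + mulV (toL2 φ) : L2) =ᵐ[volume]
      fun x => -deriv (deriv φ) x + φ x + V x * φ x := by
  filter_upwards [Lp.coeFn_add (toL2 (schwartzD 1 φ)) (mulV (toL2 φ)), coeFn_mulV (toL2 φ),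
    coeFn_toL2 φ, coeFn_toL2 (schwartzD 1 φ)] with x h1 h2 h3 h4
  rw [h1, Pi.add_apply, h2, h3, h4, schwartzD_apply]
  push_cast
  ring

/-- The potential and the ground state are real, so norm, form and projection split into real and
imaginary parts. -/
theorem gap_toL2 (φ : 𝓢(ℝ, ℂ)) :
    3 / 4 * ‖toL2 φ - (((‖groundL2‖ ^ 2 : ℝ) : ℂ)⁻¹ * inner ℂ groundL2 (toL2 φ)) • groundL2‖ ^ 2
      ≤ (inner ℂ (toL2 φ) (toL2 (schwartzD 1 φ) + mulV (toL2 φ))).re := by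
  set a := schwartzRe φ with ha
  set b := schwartzIm φ with hb
  set c := ((‖groundL2‖ ^ 2 : ℝ) : ℂ)⁻¹ * inner ℂ groundL2 (toL2 φ) with hc
  have hcre : c.re = (∫ y, groundState y * a y) / ∫ y, groundState y ^ 2 := by
    rw [hc, ← norm_groundL2_sq, ← Complex.ofReal_inv, Complex.re_ofReal_mul, inner_groundL2,
      ← RCLike.re_eq_complex_re, ← integral_re (integrable_groundState_mul φ), div_eq_inv_mul]
    congr 2
    ext x
    rw [RCLike.re_eq_complex_re, Complex.re_ofReal_mul]
    rfl
  have hcim : c.im = (∫ y, groundState y * b y) / ∫ y, groundState y ^ 2 := by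
    rw [hc, ← norm_groundL2_sq, ← Complex.ofReal_inv, Complex.im_ofReal_mul, inner_groundL2,
      ← RCLike.im_eq_complex_im, ← integral_im (integrable_groundState_mul φ), div_eq_inv_mul]
    congr 2
    ext x
    rw [RCLike.im_eq_complex_im, Complex.im_ofReal_mul]
    rfl
  have i1 : ∀ (f : 𝓢(ℝ, ℝ)) (r : ℝ), Integrable fun x => (f x - r * groundState x) ^ 2 :=
    fun f r => ((f.memLp 2 volume).sub (memLp_groundState.const_mul r)).integrable_sq
  have hl : ‖toL2 φ - c • groundL2‖ ^ 2 = (∫ x, (a x - c.re * groundState x) ^ 2)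
      + ∫ x, (b x - c.im * groundState x) ^ 2 := by
    rw [norm_sq_eq_integral, ← integral_add (i1 a _) (i1 b _)]
    refine integral_congr_ae ?_
    filter_upwards [Lp.coeFn_sub (toL2 φ) (c • groundL2), Lp.coeFn_smul c groundL2,
      coeFn_toL2 φ, coeFn_groundL2] with x h1 h2 h3 h4
    rw [h1, Pi.sub_apply, h2, Pi.smul_apply, h3, h4, ← Complex.normSq_eq_norm_sq,
      Complex.normSq_apply, ha, hb, schwartzRe_apply, schwartzIm_apply]
    simp
    ring
  have hr : (inner ℂ (toL2 φ) (toL2 (schwartzD 1 φ) + mulV (toL2 φ))).re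
      = (∫ x, a x * (-deriv (deriv a) x + a x + V x * a x))
        + ∫ x, b x * (-deriv (deriv b) x + b x + V x * b x) := by
    rw [← integral_add (integrable_form a) (integrable_form b), L2.inner_def,
      ← RCLike.re_eq_complex_re, ← integral_re (L2.integrable_inner _ _)]
    refine integral_congr_ae ?_
    filter_upwards [coeFn_schwartzD_add_mulV φ, coeFn_toL2 φ] with x h1 h2
    rw [h1, h2, ha, hb, deriv_schwartzRe, deriv_schwartzRe, deriv_schwartzIm, deriv_schwartzIm]
    simp only [schwartzRe_apply, schwartzIm_apply, RCLike.inner_apply, RCLike.re_eq_complex_re]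
    have e : SchwartzMap.derivCLM ℂ ℂ (SchwartzMap.derivCLM ℂ ℂ φ) x = deriv (deriv φ) x := rfl
    rw [e]
    simp
    ring
  rw [hl, hr, hcre, hcim, mul_add]
  exact add_le_add (gap_schwartz a) (gap_schwartz b)

/-- The integrand is the derivative of the Wronskian `groundState' φ - groundState φ'`, with
`groundState' = -kink * groundState`. -/
theorem inner_groundL2_toL2 (φ : 𝓢(ℝ, ℂ)) :
    inner ℂ groundL2 (toL2 (schwartzD 1 φ) + mulV (toL2 φ)) = 0 := by
  set φ' := SchwartzMap.derivCLM ℂ ℂ φ with hφ'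
  set φ'' := SchwartzMap.derivCLM ℂ ℂ φ' with hφ''
  have hd : ∀ x, HasDerivAt φ (φ' x) x := φ.hasDerivAt
  have hd' : ∀ x, HasDerivAt φ' (φ'' x) x := φ'.hasDerivAt
  have hae : (fun x => inner ℂ (groundL2 x) ((toL2 (schwartzD 1 φ) + mulV (toL2 φ) : L2) x))
      =ᵐ[volume] fun x => (groundState x : ℂ) * (-φ'' x + φ x + V x * φ x) := by
    filter_upwards [coeFn_schwartzD_add_mulV φ, coeFn_groundL2] with x h1 h2
    rw [h1, h2, RCLike.inner_apply, Complex.conj_ofReal, mul_comm]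
    rfl
  have hi := (L2.integrable_inner (𝕜 := ℂ) groundL2
    (toL2 (schwartzD 1 φ) + mulV (toL2 φ))).congr hae
  rw [L2.inner_def, integral_congr_ae hae]
  have hg := fun x => (hasDerivAt_groundState x).ofReal_comp
  have hk := fun x => (hasDerivAt_kink x).ofReal_comp
  have hder : ∀ x, HasDerivAt
      (fun x => -((groundState x : ℂ) * φ' x) - (kink x : ℂ) * ((groundState x : ℂ) * φ x))
      ((groundState x : ℂ) * (-φ'' x + φ x + V x * φ x)) x := by
    intro x
    refine (((hg x).mul (hd' x)).neg.sub ((hk x).mul ((hg x).mul (hd x)))).congr_deriv ?_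
    have := kink_sq x
    have hs : groundState x = 1 - kink x ^ 2 := by linarith
    simp only [Pi.mul_apply, V_eq, hs]
    push_cast
    ring
  have hlim : Tendsto
      (fun x => -((groundState x : ℂ) * φ' x) - (kink x : ℂ) * ((groundState x : ℂ) * φ x))
      (cocompact ℝ) (𝓝 0) := by
    have h0 : Tendsto φ (cocompact ℝ) (𝓝 0) := φ.tendsto_cocompact
    have h1 : Tendsto φ' (cocompact ℝ) (𝓝 0) := φ'.tendsto_cocompact
    refine squeeze_zero_norm (a := fun x => ‖φ' x‖ + ‖φ x‖) (fun x => ?_)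
      (by simpa using h1.norm.add h0.norm)
    refine (norm_sub_le _ _).trans ?_
    rw [norm_neg, norm_mul, norm_mul, norm_mul, Complex.norm_real, Complex.norm_real]
    have hg1 : ‖groundState x‖ ≤ 1 := abs_groundState_le_one x
    have hk1 : ‖kink x‖ ≤ 1 := abs_kink_le_one x
    gcongr
    · exact mul_le_of_le_one_left (norm_nonneg _) hg1
    · exact (mul_le_of_le_one_left (by positivity) hk1).trans
        (mul_le_of_le_one_left (norm_nonneg _) hg1)
  have := integral_of_hasDerivAt_of_tendsto hder hi
    (hlim.mono_left atBot_le_cocompact) (hlim.mono_left atTop_le_cocompact)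
  rw [this, sub_zero]

/-! ### Consequences for `H k` -/

theorem H_eq (k : ℝ) {u : L2} (hu : u ∈ (H k).domain) :
    H k ⟨u, hu⟩ = (D 1 ⟨u, hu⟩ + mulV u) + (k ^ 2 : ℂ) • u := by
  rw [H_apply, D_shift k 1 hu]
  push_cast
  module

theorem gap_form (u : (D 1).domain) :
    3 / 4 * ‖(u : L2) - (((‖groundL2‖ ^ 2 : ℝ) : ℂ)⁻¹ * inner ℂ groundL2 (u : L2)) • groundL2‖ ^ 2
      ≤ (inner ℂ (u : L2) (D 1 u + mulV u)).re := by
  refine D_induction one_pos (p := fun u f => 3 / 4 *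
    ‖u - (((‖groundL2‖ ^ 2 : ℝ) : ℂ)⁻¹ * inner ℂ groundL2 u) • groundL2‖ ^ 2
      ≤ (inner ℂ u (f + mulVCLM u)).re) ?_ gap_toL2 u
  exact isClosed_le (by fun_prop) (Complex.continuous_re.comp (by fun_prop))

/-- The eigenvalue equation `H k ψ = k² ψ` in weak form, which does not require the ground state to
be placed in `H²`. -/
theorem inner_groundL2_H (k : ℝ) (u : (H k).domain) :
    inner ℂ groundL2 (H k u) = (k ^ 2 : ℂ) * inner ℂ groundL2 (u : L2) := by
  have h : inner ℂ groundL2 (D 1 u + mulV u) = 0 := by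
    refine D_induction one_pos (p := fun u f => inner ℂ groundL2 (f + mulVCLM u) = 0)
      ?_ inner_groundL2_toL2 u
    exact isClosed_eq (by fun_prop) (by fun_prop)
  rw [H_eq k u.2, inner_add_right, inner_smul_right]
  erw [h]
  rw [zero_add]

theorem re_inner_H (k : ℝ) (u : (H k).domain) :
    (inner ℂ (u : L2) (H k u)).re
      = (inner ℂ (u : L2) (D 1 u + mulV u)).re + k ^ 2 * ‖(u : L2)‖ ^ 2 := by
  rw [H_eq k u.2, inner_add_right, inner_smul_right, Complex.add_re, ← Complex.ofReal_pow,
    Complex.re_ofReal_mul]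
  congr 2
  exact inner_self_eq_norm_sq (𝕜 := ℂ) _

theorem H_lower_bound (k : ℝ) (u : (H k).domain) :
    k ^ 2 * ‖(u : L2)‖ ^ 2 ≤ (inner ℂ (u : L2) (H k u)).re := by
  rw [re_inner_H]
  have := gap_form u
  have h2 : 0 ≤ (inner ℂ (u : L2) (D 1 u + mulV u)).re := le_trans (by positivity) this
  linarith

theorem H_gap (k : ℝ) (u : (H k).domain) (hu : inner ℂ groundL2 (u : L2) = 0) :
    (3 / 4 + k ^ 2) * ‖(u : L2)‖ ^ 2 ≤ (inner ℂ (u : L2) (H k u)).re := by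
  rw [re_inner_H]
  have := gap_form u
  rw [hu, mul_zero, zero_smul, sub_zero] at this
  linarith

end CahnHilliard

end

noncomputable section

namespace CahnHilliard

open MeasureTheory Filter Topology
open scoped Laplacian SchwartzMap ComplexConjugate ContDiff

/-! ### A lower bound for the form of the inverse of `D k` at the ground state -/

/-- A smooth bump function as a Schwartz function. -/
theorem exists_schwartz_bump :
    ∃ (χ : 𝓢(ℝ, ℂ)) (f : ℝ → ℝ), (∀ x, χ x = f x) ∧ (∀ x, 0 ≤ f x) ∧ ∀ x, |x| ≤ 1 → f x = 1 := by
  let β : ContDiffBump (0 : ℝ) := ⟨1, 2, one_pos, one_lt_two⟩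
  have h1 : HasCompactSupport fun x => (β x : ℂ) :=
    β.hasCompactSupport.comp_left (g := Complex.ofReal) Complex.ofReal_zero
  have h2 : ContDiff ℝ ∞ fun x => (β x : ℂ) := Complex.ofRealCLM.contDiff.comp β.contDiff
  refine ⟨h1.toSchwartzMap h2, β, fun x => rfl, fun x => β.nonneg, fun x hx => ?_⟩
  exact β.one_of_mem_closedBall (by simpa using hx)

/-- Dilation of a Schwartz function. -/
def dilate (k : ℝ) (hk : 0 < k) (χ : 𝓢(ℝ, ℂ)) : 𝓢(ℝ, ℂ) :=
  SchwartzMap.compCLMOfContinuousLinearEquiv ℂ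
    (ContinuousLinearEquiv.unitsEquivAut ℝ (Units.mk0 k hk.ne')) χ

theorem dilate_apply {k : ℝ} (hk : 0 < k) (χ : 𝓢(ℝ, ℂ)) (x : ℝ) : dilate k hk χ x = χ (k * x) := by
  rw [mul_comm]; rfl

/-- Under `x ↦ k x` the operator scales by `k²` and the measure by `k⁻¹`, so the energy of the
dilated function is of order `k`. -/
theorem inner_schwartzD_dilate {k : ℝ} (hk : 0 < k) (χ : 𝓢(ℝ, ℂ)) :
    inner ℂ (toL2 (dilate k hk χ)) (toL2 (schwartzD k (dilate k hk χ)))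
      = (k : ℂ) * ∫ x, conj (χ x) * (χ x - deriv (deriv χ) x) := by
  have h1 : ⇑(dilate k hk χ) = fun x => χ (k * x) := funext (dilate_apply hk χ)
  have h2 : deriv (dilate k hk χ) = fun x => k • deriv χ (k * x) := by
    rw [h1]; exact funext fun x => deriv_comp_mul_left k χ x
  have h3 : deriv (deriv (dilate k hk χ)) = fun x => k • k • deriv (deriv χ) (k * x) := by
    rw [h2]
    funext x
    rw [deriv_fun_const_smul_field, deriv_comp_mul_left]
  rw [inner_toL2]
  have h4 : ∀ x, conj (dilate k hk χ x) * schwartzD k (dilate k hk χ) x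
      = (k : ℂ) ^ 2 * (fun y => conj (χ y) * (χ y - deriv (deriv χ) y)) (k * x) := by
    intro x
    rw [schwartzD_apply, h3, dilate_apply]
    simp only [Complex.real_smul]
    ring
  rw [integral_congr_ae (Eventually.of_forall h4), integral_const_mul,
    Measure.integral_comp_mul_left (fun y => conj (χ y) * (χ y - deriv (deriv χ) y)), abs_of_pos (inv_pos.mpr hk),
    Complex.real_smul, ← mul_assoc]
  congr 1
  have : (k : ℂ) ≠ 0 := by exact_mod_cast hk.ne'
  push_cast
  field_simp

/-- Duality: `⟪G ψ, ψ⟫ ≥ 2 s Re ⟪ψ, η⟫ - s² ⟪η, D k η⟫` for real `s`. A bump stretched to width `1 /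
k` has energy `O(k)`, while its pairing with `ψ` stays bounded below. -/
theorem exists_inner_inverse_D_lower_bound : ∃ c : ℝ, 0 < c ∧ ∀ k : ℝ, 0 < k → k ≤ 1 →
    ∀ G : L2 →L[ℂ] L2, IsBoundedInverse (D k) G →
      c / k ≤ (inner ℂ (G groundL2) groundL2).re := by
  obtain ⟨χ, f, hχ, hf0, hf1⟩ := exists_schwartz_bump
  set p := ∫ x in Set.Icc (-1 : ℝ) 1, groundState x with hp
  have hp0 : 0 < p := by
    rw [hp, integral_Icc_eq_integral_Ioc, ← intervalIntegral.integral_of_le (by norm_num)]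
    exact intervalIntegral.intervalIntegral_pos_of_pos_on
      (continuous_groundState.intervalIntegrable _ _) (fun x _ => groundState_pos x) (by norm_num)
  set q := |(∫ x, conj (χ x) * (χ x - deriv (deriv χ) x)).re| + 1 with hq
  have hq0 : 0 < q := by positivity
  refine ⟨p ^ 2 / q, by positivity, fun k hk hk1 G hG => ?_⟩
  set η := dilate k hk χ with hη
  obtain ⟨hmem, hD⟩ := toL2_mem_domain k η
  set F := toL2 (schwartzD k η) with hF
  have hGF : G F = toL2 η := by rw [← hD]; exact hG.left_inv ⟨_, hmem⟩
  have hQ : (inner ℂ (toL2 η) F).re ≤ k * q := by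
    rw [hF, hη, inner_schwartzD_dilate hk, Complex.re_ofReal_mul]
    gcongr
    exact (le_abs_self _).trans (by rw [hq]; linarith)
  have hP : p ≤ (inner ℂ groundL2 (toL2 η)).re := by
    have hi := (integrable_groundState_mul η).re
    rw [inner_groundL2, ← RCLike.re_eq_complex_re, ← integral_re (integrable_groundState_mul η)]
    have e : ∀ x, RCLike.re ((groundState x : ℂ) * η x) = groundState x * f (k * x) := by
      intro x
      rw [RCLike.re_eq_complex_re, Complex.re_ofReal_mul, hη, dilate_apply, hχ, Complex.ofReal_re]
    simp only [e] at hi ⊢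
    calc p = ∫ x in Set.Icc (-1 : ℝ) 1, groundState x * f (k * x) := by
          refine setIntegral_congr_fun measurableSet_Icc fun x hx => ?_
          have : |k * x| ≤ 1 := by
            rw [abs_mul, abs_of_pos hk]
            exact mul_le_one₀ hk1 (abs_nonneg _) (abs_le.mpr hx)
          simp only [hf1 _ this, mul_one]
      _ ≤ ∫ x, groundState x * f (k * x) :=
          setIntegral_le_integral hi
            (Eventually.of_forall fun x => mul_nonneg (groundState_pos x).le (hf0 _))
  have hP' : (inner ℂ (toL2 η) groundL2).re = (inner ℂ groundL2 (toL2 η)).re := by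
    rw [← inner_conj_symm, Complex.conj_re]
  -- This `s` maximizes `2 s p - s² k q`, with maximum `p² / (q k)`.
  set s := p / (q * k) with hs
  have h0 : 0 ≤ (inner ℂ (G (groundL2 - (s : ℂ) • F)) (groundL2 - (s : ℂ) • F)).re :=
    le_trans (by positivity) (hG.lower_bound (D_lower_bound hk) _)
  have hexp : (inner ℂ (G (groundL2 - (s : ℂ) • F)) (groundL2 - (s : ℂ) • F)).re
      = (inner ℂ (G groundL2) groundL2).re - 2 * s * (inner ℂ groundL2 (toL2 η)).re
        + s ^ 2 * (inner ℂ (toL2 η) F).re := by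
    rw [map_sub, map_smul, hGF, inner_sub_left, inner_sub_right, inner_sub_right, inner_smul_left,
      inner_smul_right, inner_smul_left, inner_smul_right, hG.symmetric (D_symmetric hk) groundL2 F,
      hGF, Complex.conj_ofReal]
    simp only [Complex.sub_re, Complex.re_ofReal_mul, hP']
    ring
  have hs0 : 0 < s := by positivity
  have h1 : 2 * s * p ≤ 2 * s * (inner ℂ groundL2 (toL2 η)).re := by gcongr
  have h2 : s ^ 2 * (inner ℂ (toL2 η) F).re ≤ s ^ 2 * (k * q) := by gcongr
  have h3 : 2 * s * p - s ^ 2 * (k * q) = p ^ 2 / q / k := by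
    rw [hs]; field_simp; ring
  linarith

/-! ### The spectrum of `D k * H k` -/

theorem exists_inverses {k : ℝ} (hk : 0 < k) : ∃ K G : L2 →L[ℂ] L2,
    IsBoundedInverse (H k) K ∧ IsBoundedInverse (D k) G ∧ IsBoundedInverse (DH k) (K * G) := by
  obtain ⟨K, hK⟩ := exists_inverse_H (fun k _ => H_lower_bound k) hk
  obtain ⟨G, hG⟩ := exists_inverse_D hk
  exact ⟨K, G, hK, hG, hG.opMul hK⟩

theorem spectrum_DH_subset {k : ℝ} (hk : 0 < k) :
    spectrum (DH k) ⊆ Complex.ofReal '' Set.Ici (k ^ 4) := by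
  obtain ⟨K, G, hK, hG, hKG⟩ := exists_inverses hk
  intro z hz
  obtain ⟨hz0, hz'⟩ := hKG.inv_mem_spectrum hz
  have hk2 : 0 < k ^ 2 := by positivity
  obtain ⟨r, ⟨hr0, hr⟩, hrz⟩ := spectrum_mul_subset
    (hK.nonneg hk2.le (H_symmetric hk) (H_lower_bound k))
    (hG.nonneg hk2.le (D_symmetric hk) (D_lower_bound hk)) hz'
  have hzr : z = ((r⁻¹ : ℝ) : ℂ) := by rw [Complex.ofReal_inv, hrz, inv_inv]
  have hr0' : 0 < r := by
    refine lt_of_le_of_ne hr0 fun h => ?_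
    rw [← h, inv_zero] at hzr
    exact hz0 (by simpa using hzr)
  refine ⟨r⁻¹, ?_, hzr.symm⟩
  have hr' : r ≤ (k ^ 2)⁻¹ * (k ^ 2)⁻¹ := hr.trans (mul_le_mul (hK.norm_le hk2 (H_lower_bound k))
    (hG.norm_le hk2 (D_lower_bound hk)) (norm_nonneg _) (by positivity))
  rw [Set.mem_Ici, le_inv_comm₀ (by positivity) hr0']
  refine hr'.trans (le_of_eq ?_)
  rw [← mul_inv]
  ring

/-- The constant `4/3` inverts the gap `3/4`, the extra `k ^ 2` being dropped. The eigenvector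
equation for `K` follows from the weak one for `H k` by symmetry of `K`. -/
theorem rankOneGap {k : ℝ} (hk : 0 < k) {K G : L2 →L[ℂ] L2} (hK : IsBoundedInverse (H k) K)
    (hG : IsBoundedInverse (D k) G) :
    RankOneGap K G groundL2 (k ^ 2)⁻¹ (4 / 3) (k ^ 2)⁻¹ := by
  have hk2 : 0 < k ^ 2 := by positivity
  have hsym := hK.symmetric (H_symmetric hk)
  have happ : K groundL2 = (((k ^ 2)⁻¹ : ℝ) : ℂ) • groundL2 := by
    refine ext_inner_right ℂ fun f => ?_
    have h := inner_groundL2_H k ⟨_, hK.mem_domain f⟩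
    rw [hK.apply_apply] at h
    rw [hsym, inner_smul_left, h, Complex.conj_ofReal, ← mul_assoc]
    have : (k : ℂ) ≠ 0 := by exact_mod_cast hk.ne'
    push_cast
    field_simp
  refine ⟨hK.nonneg hk2.le (H_symmetric hk) (H_lower_bound k),
    hG.nonneg hk2.le (D_symmetric hk) (D_lower_bound hk), groundL2_ne_zero, happ, by norm_num,
    fun f hf => ?_, fun f => ?_, fun f => hG.injective, by positivity⟩
  · have h0 : inner ℂ groundL2 (K f) = 0 := by
      rw [← hsym, happ, inner_smul_left, hf, mul_zero]
    have h1 := H_gap k ⟨_, hK.mem_domain f⟩ h0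
    rw [hK.apply_apply] at h1
    have h2 := norm_le_of_mul_norm_sq_le_inner h1
    nlinarith [norm_nonneg (K f), mul_nonneg hk2.le (norm_nonneg (K f))]
  · rw [← div_eq_inv_mul, le_div_iff₀' hk2]
    exact hG.lower_bound (D_lower_bound hk) f

/-- For small `k` the bottom of the spectrum of `D k * H k` is a simple isolated eigenvalue of
order `k ^ 3`. -/
theorem exists_simple_eigenvalue_DH :
    ∃ ε : ℝ, 0 < ε ∧ ∃ C : ℝ, 0 < C ∧ ∀ k : ℝ, 0 < k → k < ε →
      ∃ ζ₀ : ℝ,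
        IsLeast {r : ℝ | (r : ℂ) ∈ spectrum (DH k)} ζ₀ ∧
        (∃ r : ℝ, 0 < r ∧ Metric.ball (ζ₀ : ℂ) r ∩ spectrum (DH k) = {(ζ₀ : ℂ)}) ∧
        Module.finrank ℂ (eigenspace (DH k) (ζ₀ : ℂ)) = 1 ∧
        Module.finrank ℂ (genEigenspace (DH k) (ζ₀ : ℂ)) = 1 ∧
        ζ₀ ≤ C * k ^ 3 ∧
        spectrum (DH k) \ {(ζ₀ : ℂ)} ⊆ Complex.ofReal '' Set.Ici (3 / 4 * k ^ 2) := by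
  obtain ⟨c, hc, hbound⟩ := exists_inner_inverse_D_lower_bound
  set n := ‖groundL2‖ ^ 2 with hn
  have hn0 : 0 < n := pow_pos (norm_pos_iff.mpr groundL2_ne_zero) 2
  -- The point `M` found below satisfies `M ≥ c / (n k³)`. This exceeds `(4/3) k⁻²` exactly when `k
  -- < 3c / (4n)`, and gives `M⁻¹ ≤ (n / c) k³`; `k ≤ 1` is needed for the bound on `G`.
  refine ⟨min 1 (3 * c / (4 * n)), by positivity, n / c, by positivity, fun k hk hkε => ?_⟩
  have hk1 : k ≤ 1 := (hkε.trans_le (min_le_left _ _)).le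
  have hkc : k < 3 * c / (4 * n) := hkε.trans_le (min_le_right _ _)
  obtain ⟨K, G, hK, hG, hKG⟩ := exists_inverses hk
  have hgap := rankOneGap hk hK hG
  have hlow := hbound k hk hk1 G hG
  obtain ⟨M, hMle, hM⟩ := exists_mem_spectrum_mul hgap.nonneg_left hgap.nonneg_right
    hgap.ne_zero (by positivity : 0 < (k ^ 2)⁻¹) hgap.apply_eq
    (lt_of_lt_of_le (by positivity) hlow)
  have hMn : c ≤ M * n * k ^ 3 := by
    have h1 : (k ^ 2)⁻¹ * (c / k) ≤ M * n := le_trans (by gcongr) hMle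
    have h2 : (k ^ 2)⁻¹ * (c / k) = c / k ^ 3 := by field_simp
    rwa [h2, div_le_iff₀ (by positivity)] at h1
  have hM0 : 0 < M := by
    by_contra h
    have : M * n * k ^ 3 ≤ 0 :=
      mul_nonpos_of_nonpos_of_nonneg (mul_nonpos_of_nonpos_of_nonneg (not_lt.mp h) hn0.le)
        (by positivity)
    linarith
  have hMab : 4 / 3 * (k ^ 2)⁻¹ < M := by
    rw [lt_div_iff₀ (by positivity)] at hkc
    rw [← div_eq_mul_inv, div_lt_iff₀ (by positivity)]
    have h1 : k * (4 * n) < 3 * (M * n * k ^ 3) := by linarith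
    have h2 : k * n * 4 < k * n * (3 * (M * k ^ 2)) := by linarith
    have h3 := lt_of_mul_lt_mul_left h2 (by positivity)
    linarith
  have hζ : M⁻¹ < 3 / 4 * k ^ 2 := by
    rw [inv_lt_comm₀ hM0 (by positivity)]
    refine lt_of_le_of_lt (le_of_eq ?_) hMab
    rw [mul_inv]
    norm_num
  have hMC : ((M⁻¹ : ℝ) : ℂ) ≠ 0 := by exact_mod_cast (inv_pos.mpr hM0).ne'
  have hinv : ((M⁻¹ : ℝ) : ℂ)⁻¹ = M := by rw [Complex.ofReal_inv, inv_inv]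
  have hrest : spectrum (DH k) \ {((M⁻¹ : ℝ) : ℂ)} ⊆
      Complex.ofReal '' Set.Ici (3 / 4 * k ^ 2) := by
    rintro z ⟨hz, hzM⟩
    obtain ⟨hz0, hz'⟩ := hKG.inv_mem_spectrum hz
    obtain ⟨r, ⟨hr0, -⟩, hrz⟩ := spectrum_mul_subset hgap.nonneg_left hgap.nonneg_right hz'
    have hzr : z = ((r⁻¹ : ℝ) : ℂ) := by rw [Complex.ofReal_inv, hrz, inv_inv]
    have hr0' : 0 < r := by
      refine lt_of_le_of_ne hr0 fun h => ?_
      rw [← h, inv_zero] at hzr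
      exact hz0 (by simpa using hzr)
    refine ⟨r⁻¹, ?_, hzr.symm⟩
    have hrab : r ≤ 4 / 3 * (k ^ 2)⁻¹ := by
      by_contra hlt
      rw [not_le] at hlt
      have hnot : ∀ s : ℝ, 4 / 3 * (k ^ 2)⁻¹ < s →
          (s : ℂ) ∉ Complex.ofReal '' Set.Icc 0 (4 / 3 * (k ^ 2)⁻¹) := by
        rintro s hs ⟨t, ⟨-, ht⟩, hts⟩
        have : t = s := by exact_mod_cast hts
        linarith
      rw [← hrz] at hz'
      obtain ⟨u, hu0, hu⟩ := hgap.exists_eigenvector hz' (hnot r hlt)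
      obtain ⟨v, hv0, hv⟩ := hgap.exists_eigenvector hM (hnot M hMab)
      have hrM := hgap.eigenvalue_unique hlt hMab hu0 hv0 hu hv
      exact hzM (by rw [hzr, hrM]; rfl)
    rw [Set.mem_Ici, le_inv_comm₀ (by positivity) hr0']
    refine hrab.trans (le_of_eq ?_)
    rw [mul_inv]
    norm_num
  obtain ⟨u, hu0, hu⟩ := hgap.exists_eigenvector hM (by
    rintro ⟨t, ⟨-, ht⟩, hts⟩
    have : t = M := by exact_mod_cast hts
    linarith)
  have hue : u ∈ eigenspace (DH k) ((M⁻¹ : ℝ) : ℂ) := by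
    rw [hKG.mem_eigenspace_iff hMC, hinv]
    exact hu
  have hMs : ((M⁻¹ : ℝ) : ℂ) ∈ spectrum (DH k) :=
    IsBoundedInverse.mem_spectrum_of_eigenvector hu0 hue
  have hfin : Module.finrank ℂ (eigenspace (DH k) ((M⁻¹ : ℝ) : ℂ)) = 1 := by
    rw [finrank_eq_one_iff_of_nonzero' (⟨u, hue⟩ : eigenspace (DH k) ((M⁻¹ : ℝ) : ℂ))
      (fun h => hu0 (congrArg Subtype.val h))]
    rintro ⟨w, hw⟩
    rw [hKG.mem_eigenspace_iff hMC, hinv] at hw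
    obtain ⟨d, hd⟩ := hgap.eigenvector_unique hMab hu0 hu hw
    exact ⟨d, Subtype.ext hd⟩
  -- The radius is the distance from `M⁻¹` to the threshold `3/4 * k ^ 2` bounding the rest of the
  -- spectrum.
  refine ⟨M⁻¹, ⟨hMs, fun r hr => ?_⟩, ⟨3 / 4 * k ^ 2 - M⁻¹, by linarith, ?_⟩, hfin, ?_, ?_, hrest⟩
  · by_cases h : r = M⁻¹
    · exact h.ge
    obtain ⟨t, ht, htr⟩ := hrest ⟨hr, fun h' => h (Complex.ofReal_injective h')⟩
    have : t = r := by exact_mod_cast htr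
    rw [Set.mem_Ici, this] at ht
    linarith
  · refine Set.Subset.antisymm ?_ ?_
    · rintro z ⟨hzb, hz⟩
      by_contra h
      obtain ⟨t, ht, rfl⟩ := hrest ⟨hz, h⟩
      rw [Metric.mem_ball, Complex.dist_eq, ← Complex.ofReal_sub, Complex.norm_real,
        Real.norm_eq_abs] at hzb
      have := (le_abs_self _).trans_lt hzb
      rw [Set.mem_Ici] at ht
      linarith
    · rintro z rfl
      exact ⟨Metric.mem_ball_self (by linarith), hMs⟩
  · rw [hKG.genEigenspace_eq hMC, hfin]
    intro w v hw hv
    rw [hinv] at hw hv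
    exact hgap.semisimple hw hv
  · rw [inv_le_iff_one_le_mul₀ hM0]
    have : n / c * k ^ 3 * M = M * n * k ^ 3 / c := by ring
    rw [this, one_le_div hc]
    exact hMn

end CahnHilliard

end

theorem mainTheorem6 :
    (∀ k : ℝ, 0 < k →
      CahnHilliard.spectrum (CahnHilliard.DH k) ⊆ Complex.ofReal '' Set.Ici (k ^ 4)) ∧
    ∃ ε : ℝ, 0 < ε ∧ ∃ C : ℝ, 0 < C ∧ ∀ k : ℝ, 0 < k → k < ε →
      ∃ ζ₀ : ℝ,
        IsLeast {r : ℝ | (r : ℂ) ∈ CahnHilliard.spectrum (CahnHilliard.DH k)} ζ₀ ∧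
        (∃ r : ℝ, 0 < r ∧
          Metric.ball (ζ₀ : ℂ) r ∩ CahnHilliard.spectrum (CahnHilliard.DH k) = {(ζ₀ : ℂ)}) ∧
        Module.finrank ℂ (CahnHilliard.eigenspace (CahnHilliard.DH k) (ζ₀ : ℂ)) = 1 ∧
        Module.finrank ℂ (CahnHilliard.genEigenspace (CahnHilliard.DH k) (ζ₀ : ℂ)) = 1 ∧
        ζ₀ ≤ C * k ^ 3 ∧
        CahnHilliard.spectrum (CahnHilliard.DH k) \ {(ζ₀ : ℂ)} ⊆
          Complex.ofReal '' Set.Ici (3 / 4 * k ^ 2) :=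
  ⟨fun _ hk => CahnHilliard.spectrum_DH_subset hk, CahnHilliard.exists_simple_eigenvalue_DH⟩
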